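/- Let $0\le\varphi<1/2$, $\epsilon=2\varphi(1-\varphi)$, and let $h$ be the binary entropy function; entropies are in bits. Let $C_0$ be a binary linear code of length $n_0\ge 1$ and dimension $k$, with parity-check matrix $\mathbf H_0$ and rate $R_0=k/n_0$. Consider the following protocol $P_0$ between an honest Alice, who holds two independent uniform secrets $x,y\in\mathbb F_2^m$, and Bob. * A uniformly random binary $m\times n_0$ matrix $\mathbf H_1$ is made public. * Alice draws a uniform string $\mathbf r\in\mathbb F_2^{2n_0}$ and sends each $r_i$ as a pair $(r_i,r_i)$ over a binary symmetric channel with crossover probability $\varphi$. A received pair with two different bits is an erasure. * Bob announces a partition of $\{1,\dots,2n_0\}$ into two sets $I,J$ of size $n_0$. He may be dishonest: the partition may be any (possibly randomized) function of $\mathbf H_1$ and of all that he has received. Alice then permutes $I$ and $J$ by independent uniformly random permutations and makes these public. * Alice picks $\mathbf c_x$, $\mathbf c_y$ independently and uniformly among the $\mathbf c\in C_0$ with $\mathbf H_1\mathbf c=x$, respectively $\mathbf H_1\mathbf c=y$, and sends $\mathbf c_x+\mathbf r_I$ and $\mathbf c_y+\mathbf r_J$ to Bob noiselessly. (When no such codeword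 exists for one of the secrets, she sends a failure symbol for this secret instead.) Let $\mathcal O$ be Bob's view: $\mathbf H_1$, the received pairs, the partition, the permutations and the two messages of Alice. Let $X$ be the secret sent over the noisier of the two virtual channels: $X=x$ if $I$ contains at least as many erasures as $J$, and $X=y$ otherwise. **Theorem.** For every $\varphi\in[0,1/2)$ there is a function $f_0(\varepsilon',m)\ge 0$ which, for every fixed $\varepsilon'>0$, is exponentially small in $m$ (that is, $f_0(\varepsilon',m)\le A e^{-cm}$ for all $m$, with constants $A$ and $c>0$ depending only on $\varphi$ and $\varepsilon'$), such that the following holds. For all $\varepsilon'>0$, all $n_0\ge1$, $k$, $m$, every $(n_0,k)$ linear code $C_0$ with parity-check matrix $\mathbf H_0$, and every strategy of Bob, if $$m\le n_0\Bigl[R_0-(1-\epsilon)\Bigl(1-h\Bigl(\tfrac{\varphi^2}{1-\epsilon}\Bigr)\Bigr)-\varepsilon'\Bigr],$$ then $$H(X\mid\mathcal O)\ge m-f_0(\varepsilon',m),$$ where $\mathbf H_1$ is random and part of $\mathcal O$; moreover, with probability at least $1-f_0(\varepsilon',m)$ over the choice of $\mathbf H_1$, the same bound holds for the conditional entropy $H(X\mid\mathcal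 O)$ in the protocol run with this fixed $\mathbf H_1$. -/

import Mathlib

open scoped Matrix

noncomputable section

namespace ObliviousTransfer

/-! ### Entropy -/

/-- The binary entropy function `h`, in bits. -/
def binaryEntropy (p : ℝ) : ℝ := Real.binEntropy p / Real.log 2

/-- Shannon's conditional entropy `H(X | O) = ∑ₒ P(O = o) H(X | O = o)`, in bits, of a random
variable `X` given a random variable `O` on a discrete probability space `μ`
(values `o` of probability zero contribute zero). -/
def condEntropy {Ω α β : Type} [Fintype α] [Fintype β]
    (μ : PMF Ω) (X : Ω → α) (O : Ω → β) : ℝ :=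
  ∑ o, (μ.map O o).toReal *
    ∑ x, Real.negMulLog
      ((μ.map (fun ω => (X ω, O ω)) (x, o)).toReal / (μ.map O o).toReal) / Real.log 2

/-- The law of a family of independent random variables with laws `p i`. -/
def independent {ι α : Type} [Fintype ι] [DecidableEq ι] [Fintype α] (p : ι → PMF α) :
    PMF (ι → α) :=
  PMF.ofFintype (fun f => ∏ i, p i (f i)) (by
    have h := Finset.prod_univ_sum (fun _ : ι => (Finset.univ : Finset α)) (fun i a => p i a)
    rw [Fintype.piFinset_univ] at h
    rw [← h]
    refine Finset.prod_eq_one fun i _ => ?_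
    rw [← tsum_fintype (L := SummationFilter.unconditional _)]
    exact (p i).tsum_coe)

/-! ### The channel -/

/-- Binary words of length `n`. -/
abbrev Word (n : ℕ) : Type := Fin n → ZMod 2

/-- The output law of the binary symmetric channel with crossover probability `φ`
on the input bit `b`. -/
def bsc (φ : unitInterval) (b : ZMod 2) : PMF (ZMod 2) :=
  PMF.ofFintype (fun a => if a = b then ENNReal.ofReal (1 - φ) else ENNReal.ofReal φ) (by
    have h : ENNReal.ofReal (1 - φ) + ENNReal.ofReal φ = 1 := by
      rw [← ENNReal.ofReal_add (sub_nonneg.2 φ.2.2) φ.2.1]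
      simp
    have h2 : (Finset.univ : Finset (ZMod 2)) = {0, 1} := rfl
    rw [h2, Finset.sum_pair (by decide)]
    have hb : b = 0 ∨ b = 1 := by
      revert b
      decide
    rcases hb with rfl | rfl
    · rw [if_pos rfl, if_neg (by decide)]
      exact h
    · rw [if_neg (by decide), if_pos rfl, add_comm]
      exact h)

/-- What Bob receives over the noisy channel: `2 n₀` pairs of bits. -/
abbrev Received (n₀ : ℕ) : Type := Fin (2 * n₀) → ZMod 2 × ZMod 2

/-- Every bit `r i` is sent as the duplicate pair `(r i, r i)`, over `4 n₀` independent uses of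
the binary symmetric channel. -/
def transmit (φ : unitInterval) {n₀ : ℕ} (r : Word (2 * n₀)) : PMF (Received n₀) :=
  independent fun i => (bsc φ (r i)).bind fun a => (bsc φ (r i)).map fun b => (a, b)

/-! ### Bob's partition of the positions -/

/-- A partition of the `2 n₀` positions into two sets `I`, `J` of size `n₀`, given by `I`. -/
abbrev Partition (n₀ : ℕ) : Type := {I : Finset (Fin (2 * n₀)) // I.card = n₀}

/-- The other half `J` of the partition. -/
def Partition.compl {n₀ : ℕ} (I : Partition n₀) : Partition n₀ :=
  ⟨(I : Finset (Fin (2 * n₀)))ᶜ, by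
    rw [Finset.card_compl, I.2, Fintype.card_fin]
    omega⟩

/-- The word `r_I`: the symbols of `r` on the positions of `I`, read in increasing order and then
rearranged by the permutation `σ`. -/
def restrict {n₀ : ℕ} (r : Word (2 * n₀)) (I : Partition n₀) (σ : Equiv.Perm (Fin n₀)) :
    Word n₀ :=
  fun i => r ((I : Finset (Fin (2 * n₀))).orderEmbOfFin I.2 (σ i))

/-- The number of erasures among the positions of `I`; a received pair counts as an erasure when
its two bits differ. -/
def erasures {n₀ : ℕ} (z : Received n₀) (I : Partition n₀) : ℕ :=
  ((I : Finset (Fin (2 * n₀))).filter fun i => (z i).1 ≠ (z i).2).card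

/-- A (possibly randomized) strategy of a possibly dishonest Bob: knowing the public matrix `H₁`
and everything he has received over the noisy channel, he picks the partition that he announces. -/
abbrev Strategy (m n₀ : ℕ) : Type :=
  Matrix (Fin m) (Fin n₀) (ZMod 2) → Received n₀ → PMF (Partition n₀)

/-! ### Alice's encoding -/

/-- The words `c` with `H' c = (0, x)`, where `H'` is `H₀` stacked upon `H₁`. -/
def encodings {s m n₀ : ℕ} (H₀ : Matrix (Fin s) (Fin n₀) (ZMod 2))
    (H₁ : Matrix (Fin m) (Fin n₀) (ZMod 2)) (x : Word m) : Finset (Word n₀) :=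
  Finset.univ.filter fun c => Matrix.fromRows H₀ H₁ *ᵥ c = Sum.elim (0 : Word s) x

open Classical in
/-- Alice picks `c` with `H' c = (0, x)` uniformly at random. When there is no such word, which
can happen if the rows of `H₁` are dependent modulo those of `H₀`, she sends a failure
symbol `none` instead. -/
def encode {s m n₀ : ℕ} (H₀ : Matrix (Fin s) (Fin n₀) (ZMod 2))
    (H₁ : Matrix (Fin m) (Fin n₀) (ZMod 2)) (x : Word m) : PMF (Option (Word n₀)) :=
  if h : (encodings H₀ H₁ x).Nonempty then (PMF.uniformOfFinset (encodings H₀ H₁ x) h).map some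
  else PMF.pure none

/-! ### The protocol -/

/-- A complete run of the protocol. -/
structure Run (m n₀ : ℕ) where
  /-- the public hash matrix -/
  H₁ : Matrix (Fin m) (Fin n₀) (ZMod 2)
  /-- Alice's first secret -/
  x : Word m
  /-- Alice's second secret -/
  y : Word m
  /-- Alice's random bits -/
  r : Word (2 * n₀)
  /-- the pairs received by Bob -/
  z : Received n₀
  /-- Bob's partition `(I, J)` -/
  I : Partition n₀
  /-- Alice's permutation of `I` -/
  σ : Equiv.Perm (Fin n₀)
  /-- Alice's permutation of `J` -/
  τ : Equiv.Perm (Fin n₀)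
  /-- the encoding of `x` -/
  cx : Option (Word n₀)
  /-- the encoding of `y` -/
  cy : Option (Word n₀)

/-- The law of a run with an honest Alice, whose two secrets are independent and uniform, for a
given hash matrix `H₁`. -/
def protocolGiven (φ : unitInterval) {s m n₀ : ℕ} (H₀ : Matrix (Fin s) (Fin n₀) (ZMod 2))
    (bob : Strategy m n₀) (H₁ : Matrix (Fin m) (Fin n₀) (ZMod 2)) : PMF (Run m n₀) :=
  (PMF.uniformOfFintype (Word m)).bind fun x =>
  (PMF.uniformOfFintype (Word m)).bind fun y =>
  (PMF.uniformOfFintype (Word (2 * n₀))).bind fun r =>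
  (transmit φ r).bind fun z =>
  (bob H₁ z).bind fun I =>
  (PMF.uniformOfFintype (Equiv.Perm (Fin n₀))).bind fun σ =>
  (PMF.uniformOfFintype (Equiv.Perm (Fin n₀))).bind fun τ =>
  (encode H₀ H₁ x).bind fun cx =>
  (encode H₀ H₁ y).bind fun cy =>
  PMF.pure ⟨H₁, x, y, r, z, I, σ, τ, cx, cy⟩

/-- The law of a run of the protocol, with a uniformly random hash matrix `H₁`. -/
def protocol (φ : unitInterval) {s m n₀ : ℕ} (H₀ : Matrix (Fin s) (Fin n₀) (ZMod 2))
    (bob : Strategy m n₀) : PMF (Run m n₀) :=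
  (PMF.uniformOfFintype (Matrix (Fin m) (Fin n₀) (ZMod 2))).bind fun H₁ =>
    protocolGiven φ H₀ bob H₁

/-- Everything that Bob can observe. -/
abbrev View (m n₀ : ℕ) : Type :=
  Matrix (Fin m) (Fin n₀) (ZMod 2) × Received n₀ × Partition n₀ ×
    Equiv.Perm (Fin n₀) × Equiv.Perm (Fin n₀) × Option (Word n₀) × Option (Word n₀)

/-- Bob's view of a run: `H₁`, the received pairs, the partition, the two permutations, and
Alice's messages `c_x + r_I` and `c_y + r_J`. -/
def Run.view {m n₀ : ℕ} (ω : Run m n₀) : View m n₀ :=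
  (ω.H₁, ω.z, ω.I, ω.σ, ω.τ,
    ω.cx.map fun c => c + restrict ω.r ω.I ω.σ,
    ω.cy.map fun c => c + restrict ω.r ω.I.compl ω.τ)

/-- The secret sent over the noisier of Bob's two virtual channels, that is, the one whose set of
positions contains more erasures. -/
def Run.noisierSecret {m n₀ : ℕ} (ω : Run m n₀) : Word m :=
  if erasures ω.z ω.I.compl ≤ erasures ω.z ω.I then ω.x else ω.y

end ObliviousTransfer

end

/-! Fix `H₁`. By Bayes' rule the received pairs may be drawn first and Alice's bits afterwards: they
are then independent, each uniform at an erasure, and otherwise the first received bit plus noise of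
bias `φ² / (1 - ε)` (`uniform_bind_transmit`). Given the pairs and the partition, `r_I` and `r_J`
are therefore independent, so the message carrying the other secret says nothing about `X`
(`pairEntropy_viewLaw`). If every secret has an encoding, Bob's uncertainty about `X` equals the
entropy of the hash `H₁ u` given the syndrome `H₀ u` of the noise `u`, that is, `m` minus a
`deficiency` (`IsOnto.pairEntropy_channelLaw`).

For a fixed law of `u`, privacy amplification with a Rényi moment of order `1 + 2α` bounds the mean
deficiency over `H₁` (`IsUniversal.sum_deficiency_le`). Bob, however, chooses the partition knowing
`H₁`. Alice's permutation repairs this: averaged over it, the deficiency depends only on `H₁` and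
the number `e` of erasures in the noisier half (`sum_perm_eq_of_weight_eq`). There are at most `n₀ +
1` values of `e`, all at least half of the total, and `loss` simply adds their deficiencies,
together with `m` when some secret has no encoding. Hence `loss` bounds what Bob learns under every
strategy (`le_condEntropy_protocolGiven`).

The mean of `loss` over `H₁` factorizes over the `2 n₀` positions (`sum_loss_le`). The resulting
base equals `1` at `α = 0` and has derivative `-δ log 2` there, where `δ` is the gap `ε'` in the
rate, so some small `α` makes it less than `1` (`exists_exponent`). Averaging gives the bound for
random `H₁`, and Markov's inequality the bound for most fixed `H₁`. -/

noncomputable section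

namespace ObliviousTransfer

/-! ### Conditional entropy of a joint law -/

/-- The entropy, in bits, of the normalization of a finite family of weights, times its mass. -/
def massEntropy {α : Type} [Fintype α] (v : α → ℝ) : ℝ :=
  (∑ x, v x) * ∑ x, Real.negMulLog (v x / ∑ x', v x') / Real.log 2

theorem massEntropy_zero {α : Type} [Fintype α] : massEntropy (fun _ : α => 0) = 0 := by
  simp [massEntropy]

theorem massEntropy_const_mul {α : Type} [Fintype α] (c : ℝ) (v : α → ℝ) :
    massEntropy (fun x => c * v x) = c * massEntropy v := by
  rcases eq_or_ne c 0 with rfl | hc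
  · simp [massEntropy]
  · simp only [massEntropy, ← Finset.mul_sum, mul_div_mul_left _ _ hc, mul_assoc]

theorem massEntropy_nonneg {α : Type} [Fintype α] {v : α → ℝ} (hv : ∀ x, 0 ≤ v x) :
    0 ≤ massEntropy v := by
  have hs : 0 ≤ ∑ x, v x := Finset.sum_nonneg fun x _ => hv x
  refine mul_nonneg hs (Finset.sum_nonneg fun x _ => div_nonneg ?_ (Real.log_nonneg (by norm_num)))
  refine Real.negMulLog_nonneg (div_nonneg (hv x) hs) (div_le_one_of_le₀ ?_ hs)
  exact Finset.single_le_sum (fun y _ => hv y) (Finset.mem_univ x)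

/-- The conditional entropy of the first component given the second one. -/
def pairEntropy {α β : Type} [Fintype α] [Fintype β] (ν : PMF (α × β)) : ℝ :=
  ∑ o, massEntropy fun x => (ν (x, o)).toReal

theorem pairEntropy_nonneg {α β : Type} [Fintype α] [Fintype β] (ν : PMF (α × β)) :
    0 ≤ pairEntropy ν :=
  Finset.sum_nonneg fun _ _ => massEntropy_nonneg fun _ => ENNReal.toReal_nonneg

theorem toReal_map_snd {α β : Type} [Fintype α] [Fintype β] (ν : PMF (α × β)) (o : β) :
    (ν.map Prod.snd o).toReal = ∑ x, (ν (x, o)).toReal := by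
  classical
  rw [← ENNReal.toReal_sum fun x _ => ν.apply_ne_top _, PMF.map_apply, tsum_fintype,
    Fintype.sum_prod_type]
  simp

theorem condEntropy_eq_pairEntropy {Ω α β : Type} [Fintype α] [Fintype β]
    (μ : PMF Ω) (X : Ω → α) (O : Ω → β) :
    condEntropy μ X O = pairEntropy (μ.map fun ω => (X ω, O ω)) := by
  refine Finset.sum_congr rfl fun o _ => ?_
  have h : (μ.map O o).toReal = ∑ x, (μ.map (fun ω => (X ω, O ω)) (x, o)).toReal := by
    rw [← toReal_map_snd, PMF.map_comp]
    rfl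
  rw [massEntropy, h]

/-- The entropy of a mixture is the mean entropy, if the second component determines the
component of the mixture. -/
theorem pairEntropy_bind {α β κ : Type} [Fintype α] [Fintype β] [Fintype κ]
    (p : PMF κ) (μ : κ → PMF (α × β)) (label : β → κ)
    (h : ∀ k x o, μ k (x, o) ≠ 0 → label o = k) :
    pairEntropy (p.bind μ) = ∑ k, (p k).toReal * pairEntropy (μ k) := by
  simp only [pairEntropy, Finset.mul_sum]
  rw [Finset.sum_comm]
  refine Finset.sum_congr rfl fun o _ => ?_
  have hz : ∀ k, k ≠ label o → ∀ x, μ k (x, o) = 0 := fun k hk x => by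
    by_contra hne
    exact hk (h k x o hne).symm
  rw [Finset.sum_eq_single (label o)]
  · rw [← massEntropy_const_mul]
    congr 1
    funext x
    rw [PMF.bind_apply, tsum_eq_single (label o), ENNReal.toReal_mul]
    intro k hk
    rw [hz k hk, mul_zero]
  · intro k _ hk
    simp [hz k hk, massEntropy_zero]
  · simp

theorem pairEntropy_map_of_injective {α β γ : Type} [Fintype α] [Fintype β] [Fintype γ]
    (ν : PMF (α × β)) {f : β → γ} (hf : Function.Injective f) :
    pairEntropy (ν.map fun a => (a.1, f a.2)) = pairEntropy ν := by
  classical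
  symm
  refine Finset.sum_of_injOn f hf.injOn (by simp) ?_ ?_
  · intro o _ ho
    have : ∀ x, (ν.map (fun a => (a.1, f a.2))) (x, o) = 0 := fun x => by
      rw [PMF.apply_eq_zero_iff, PMF.mem_support_map_iff]
      rintro ⟨a, -, ha⟩
      exact ho ⟨a.2, by simp, (Prod.ext_iff.1 ha).2⟩
    simp [this, massEntropy_zero]
  · intro o _
    congr 1
    funext x
    congr 1
    rw [PMF.map_apply, tsum_eq_single (x, o)]
    · simp
    · rintro ⟨x', o'⟩ hne
      refine if_neg fun he => hne ?_
      simp only [Prod.mk.injEq] at he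
      rw [he.1, hf he.2]

/-! ### Independent families -/

theorem independent_apply {ι α : Type} [Fintype ι] [DecidableEq ι] [Fintype α] (p : ι → PMF α)
    (f : ι → α) : independent p f = ∏ i, p i (f i) := rfl

theorem independent_pure {ι α : Type} [Fintype ι] [DecidableEq ι] [Fintype α] (f : ι → α) :
    independent (fun i => PMF.pure (f i)) = PMF.pure f := by
  classical
  ext g
  simp only [independent_apply, PMF.pure_apply, Finset.prod_boole, Finset.mem_univ, true_implies,
    funext_iff]

/-- Distributivity: a sum over functions of a product is the product of the coordinatewise sums. -/
theorem independent_bind {ι α β : Type} [Fintype ι] [DecidableEq ι] [Fintype α] [Fintype β]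
    (p : ι → PMF α) (k : ι → α → PMF β) :
    ((independent p).bind fun f => independent fun i => k i (f i)) =
      independent fun i => (p i).bind (k i) := by
  ext g
  simp only [PMF.bind_apply, independent_apply, tsum_fintype, ← Finset.prod_mul_distrib]
  rw [Finset.prod_univ_sum, Fintype.piFinset_univ]

theorem independent_map {ι α β : Type} [Fintype ι] [DecidableEq ι] [Fintype α] [Fintype β]
    (p : ι → PMF α) (g : ι → α → β) :
    (independent p).map (fun f i => g i (f i)) = independent fun i => (p i).map (g i) := by
  have h := independent_bind p fun i a => PMF.pure (g i a)
  simp only [independent_pure] at h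
  exact h

theorem uniformOfFintype_pi {ι α : Type} [Fintype ι] [DecidableEq ι] [Fintype α] [Nonempty α] :
    PMF.uniformOfFintype (ι → α) = independent fun _ => PMF.uniformOfFintype α := by
  ext f
  simp only [independent_apply, PMF.uniformOfFintype_apply, Fintype.card_pi, Finset.prod_const,
    Nat.cast_pow, ENNReal.inv_pow]

/-- Bayes' rule for a two-step experiment. -/
theorem bind_bind_eq_of_mul_eq_mul {α β γ : Type} (p : PMF α) (k : α → PMF β) (q : PMF β)
    (l : β → PMF α) (h : ∀ a b, p a * k a b = q b * l b a) (F : α → β → PMF γ) :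
    (p.bind fun a => (k a).bind fun b => F a b) = q.bind fun b => (l b).bind fun a => F a b := by
  ext c
  simp only [PMF.bind_apply, ← ENNReal.tsum_mul_left, ← mul_assoc, h]
  exact ENNReal.tsum_comm

/-- Independent coordinates split along a partition of the index set. -/
theorem independent_bind_split {ι ι₁ ι₂ α γ : Type} [Fintype ι] [DecidableEq ι] [Fintype ι₁]
    [DecidableEq ι₁] [Fintype ι₂] [DecidableEq ι₂] [Fintype α] (e : ι₁ ⊕ ι₂ ≃ ι)
    (p : ι → PMF α) (F : (ι₁ → α) → (ι₂ → α) → PMF γ) :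
    ((independent p).bind fun r => F (fun i => r (e (.inl i))) (fun i => r (e (.inr i)))) =
      (independent fun i => p (e (.inl i))).bind fun u =>
        (independent fun i => p (e (.inr i))).bind fun v => F u v := by
  ext c
  simp only [PMF.bind_apply, tsum_fintype, Finset.mul_sum, ← mul_assoc]
  rw [← Fintype.sum_prod_type']
  refine Fintype.sum_equiv ((Equiv.arrowCongr e.symm (Equiv.refl α)).trans
    (Equiv.sumArrowEquivProdArrow ι₁ ι₂ α)) _ _ fun r => ?_
  simp only [independent_apply]
  congr 1
  rw [← Equiv.prod_comp e, Fintype.prod_sum_type]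
  rfl

/-! ### The duplicated bit -/

theorem bit_eq (a : ZMod 2) : a = 0 ∨ a = 1 := by
  revert a
  decide

/-- The two received copies of the bit `b`. -/
def pairChannel (φ : unitInterval) (b : ZMod 2) : PMF (ZMod 2 × ZMod 2) :=
  (bsc φ b).bind fun a => (bsc φ b).map fun a' => (a, a')

theorem bsc_apply (φ : unitInterval) (b a : ZMod 2) :
    bsc φ b a = ENNReal.ofReal (if a = b then 1 - φ else φ) := by
  rw [bsc, PMF.ofFintype_apply]
  split_ifs <;> rfl

theorem pairChannel_apply (φ : unitInterval) (b : ZMod 2) (z : ZMod 2 × ZMod 2) :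
    pairChannel φ b z = bsc φ b z.1 * bsc φ b z.2 := by
  classical
  rw [pairChannel, PMF.bind_apply, tsum_eq_single z.1]
  · congr 1
    rw [PMF.map_apply, tsum_eq_single z.2]
    · simp
    · intro a ha
      exact if_neg fun h => ha (congrArg Prod.snd h).symm
  · intro a ha
    rw [PMF.map_apply, ENNReal.tsum_eq_zero.2, mul_zero]
    intro a'
    exact if_neg fun h => ha (congrArg Prod.fst h).symm

theorem erasureProb_le (φ : ℝ) : 2 * φ * (1 - φ) ≤ 1 / 2 := by
  nlinarith [sq_nonneg (2 * φ - 1)]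

/-- The crossover probability of the channel that remains when there is no erasure. -/
def residualCrossover (φ : unitInterval) : unitInterval :=
  ⟨(φ : ℝ) ^ 2 / (1 - 2 * φ * (1 - φ)), by
    have h := erasureProb_le φ
    constructor
    · exact div_nonneg (sq_nonneg _) (by linarith)
    · rw [div_le_one (by linarith)]
      nlinarith [sq_nonneg (1 - (φ : ℝ))]⟩

/-- Whether a received pair counts as an erasure. -/
def erased (z : ZMod 2 × ZMod 2) : Bool := decide (z.1 ≠ z.2)

/-- The difference of the sent bit and the first received bit, given whether there is an
erasure. -/
def noise (p : unitInterval) (e : Bool) : PMF (ZMod 2) :=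
  if e then PMF.uniformOfFintype (ZMod 2) else bsc p 0

/-- The law of the sent bit given the received pair. -/
def posterior (φ : unitInterval) (z : ZMod 2 × ZMod 2) : PMF (ZMod 2) :=
  (noise (residualCrossover φ) (erased z)).map fun b => b + z.1

/-- The law of a received pair. -/
def pairLaw (φ : unitInterval) : PMF (ZMod 2 × ZMod 2) :=
  (PMF.uniformOfFintype (ZMod 2)).bind (pairChannel φ)

theorem uniform_bit_apply (a : ZMod 2) :
    PMF.uniformOfFintype (ZMod 2) a = ENNReal.ofReal (1 / 2) := by
  rw [PMF.uniformOfFintype_apply, ZMod.card, one_div, ENNReal.ofReal_inv_of_pos (by norm_num)]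
  norm_num

theorem univ_zmod_two : (Finset.univ : Finset (ZMod 2)) = {0, 1} := rfl

theorem pairLaw_apply (φ : unitInterval) (z : ZMod 2 × ZMod 2) :
    pairLaw φ z = ENNReal.ofReal
      (if erased z then φ * (1 - φ) else (1 - 2 * φ * (1 - φ)) / 2) := by
  have h0 := φ.2.1
  have h1 : 0 ≤ 1 - (φ : ℝ) := sub_nonneg.2 φ.2.2
  rw [pairLaw, PMF.bind_apply, tsum_fintype, univ_zmod_two, Finset.sum_pair (by decide)]
  simp only [uniform_bit_apply, pairChannel_apply, bsc_apply]
  have hn : ∀ a b : ZMod 2, 0 ≤ (if a = b then 1 - (φ : ℝ) else φ) := fun a b => by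
    split_ifs <;> assumption
  rw [← ENNReal.ofReal_mul (hn _ _), ← ENNReal.ofReal_mul (hn _ _),
    ← ENNReal.ofReal_mul (by norm_num), ← ENNReal.ofReal_mul (by norm_num),
    ← ENNReal.ofReal_add (mul_nonneg (by norm_num) (mul_nonneg (hn _ _) (hn _ _)))
      (mul_nonneg (by norm_num) (mul_nonneg (hn _ _) (hn _ _)))]
  congr 1
  obtain ⟨a, b⟩ := z
  rcases bit_eq a with rfl | rfl <;> rcases bit_eq b with rfl | rfl <;> simp [erased] <;> ring

theorem noise_apply (p : unitInterval) (e : Bool) (a : ZMod 2) :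
    noise p e a = ENNReal.ofReal (if e then 1 / 2 else if a = 0 then 1 - p else p) := by
  cases e
  · simp [noise, bsc_apply]
  · simp only [noise, if_true, uniform_bit_apply]

theorem posterior_apply (φ : unitInterval) (z : ZMod 2 × ZMod 2) (b : ZMod 2) :
    posterior φ z b = noise (residualCrossover φ) (erased z) (b - z.1) := by
  classical
  rw [posterior, PMF.map_apply, tsum_eq_single (b - z.1)]
  · simp
  · intro a ha
    exact if_neg fun h => ha (by rw [h, add_sub_cancel_right])

/-- Bayes' rule for one bit. Unequal copies have likelihood `φ (1 - φ)` under either bit, hence a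
uniform posterior; for equal copies the likelihoods are `φ²` and `(1 - φ)²`, with sum `1 - 2φ(1 -
φ)`. -/
theorem uniform_mul_pairChannel (φ : unitInterval) (b : ZMod 2) (z : ZMod 2 × ZMod 2) :
    PMF.uniformOfFintype (ZMod 2) b * pairChannel φ b z = pairLaw φ z * posterior φ z b := by
  have h0 := φ.2.1
  have h1 : 0 ≤ 1 - (φ : ℝ) := sub_nonneg.2 φ.2.2
  have h2 := erasureProb_le φ
  have h3 : 1 - 2 * (φ : ℝ) * (1 - φ) ≠ 0 := by linarith
  have hn : ∀ a b : ZMod 2, 0 ≤ (if a = b then 1 - (φ : ℝ) else φ) := fun a b => by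
    split_ifs <;> assumption
  rw [uniform_bit_apply, pairChannel_apply, pairLaw_apply, posterior_apply, noise_apply,
    bsc_apply, bsc_apply, ← ENNReal.ofReal_mul (hn _ _), ← ENNReal.ofReal_mul (by norm_num),
    ← ENNReal.ofReal_mul]
  · congr 1
    obtain ⟨a, a'⟩ := z
    rcases bit_eq a with rfl | rfl <;> rcases bit_eq a' with rfl | rfl <;>
      rcases bit_eq b with rfl | rfl <;> simp [erased, residualCrossover] <;> field_simp <;> ring
  · split_ifs
    · exact mul_nonneg h0 h1
    · linarith

/-- The law of the received pairs. -/
def receivedLaw (φ : unitInterval) (n₀ : ℕ) : PMF (Received n₀) :=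
  independent fun _ => pairLaw φ

/-- The received pairs come first, and the bits of Alice are drawn from their posterior law. -/
theorem uniform_bind_transmit {γ : Type} (φ : unitInterval) {n₀ : ℕ}
    (F : Word (2 * n₀) → Received n₀ → PMF γ) :
    ((PMF.uniformOfFintype (Word (2 * n₀))).bind fun r => (transmit φ r).bind fun z => F r z) =
      (receivedLaw φ n₀).bind fun z =>
        (independent fun i => posterior φ (z i)).bind fun r => F r z := by
  refine bind_bind_eq_of_mul_eq_mul _ _ _ _ (fun r z => ?_) F
  rw [uniformOfFintype_pi]
  simp only [transmit, receivedLaw, independent_apply, ← Finset.prod_mul_distrib]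
  exact Finset.prod_congr rfl fun i _ => uniform_mul_pairChannel φ (r i) (z i)

/-! ### Hashing in finite groups -/

open Classical in
/-- The mass of the fiber of `f` over `s`. -/
def fiberMass {V S : Type} [Fintype V] (f : V → S) (P : V → ℝ) (s : S) : ℝ :=
  ∑ v with f v = s, P v

section fiberMass

variable {V S T : Type} [Fintype V]

theorem fiberMass_nonneg (f : V → S) {P : V → ℝ} (hP : ∀ v, 0 ≤ P v) (s : S) :
    0 ≤ fiberMass f P s :=
  Finset.sum_nonneg fun v _ => hP v

theorem fiberMass_eq_zero (f : V → S) (P : V → ℝ) {s : S} (h : ∀ v, f v ≠ s) :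
    fiberMass f P s = 0 := by
  classical
  rw [fiberMass, Finset.filter_eq_empty_iff.2 fun v _ => h v, Finset.sum_empty]

theorem le_fiberMass (f : V → S) {P : V → ℝ} (hP : ∀ v, 0 ≤ P v) (v : V) :
    P v ≤ fiberMass f P (f v) :=
  Finset.single_le_sum (f := P) (fun w _ => hP w) (by simp)

theorem sum_mul_comp_eq [Fintype S] (f : V → S) (P : V → ℝ) (φ : S → ℝ) :
    ∑ v, P v * φ (f v) = ∑ s, fiberMass f P s * φ s := by
  classical
  rw [← Finset.sum_fiberwise Finset.univ f]
  refine Finset.sum_congr rfl fun s _ => ?_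
  rw [fiberMass, Finset.sum_mul]
  refine Finset.sum_congr (by congr) fun v hv => ?_
  rw [(Finset.mem_filter.1 hv).2]

theorem sum_fiberMass [Fintype S] (f : V → S) (P : V → ℝ) : ∑ s, fiberMass f P s = ∑ v, P v := by
  have h := sum_mul_comp_eq f P fun _ => 1
  simpa using h.symm

theorem sum_fiberMass_prod [Fintype T] (f : V → S) (g : V → T) (P : V → ℝ) (s : S) :
    ∑ t, fiberMass (fun v => (f v, g v)) P (s, t) = fiberMass f P s := by
  classical
  rw [fiberMass, ← Finset.sum_fiberwise _ g]
  refine Finset.sum_congr rfl fun t _ => ?_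
  rw [fiberMass, Finset.filter_filter]
  simp only [Prod.mk.injEq]

/-- How much, in bits, the entropy of `g` given `f` falls short of that of a uniform variable. -/
def deficiency [Fintype T] (f : V → S) (g : V → T) (P : V → ℝ) : ℝ :=
  ∑ v, P v * (Real.log (Fintype.card T *
    (fiberMass (fun v => (f v, g v)) P (f v, g v) / fiberMass f P (f v))) / Real.log 2)

/-- Gibbs' inequality: `log x ≥ 1 - 1 / x`, and the mean of `1 / x` is at most `1`. It may be
smaller, as pairs `(s, t)` of mass zero drop out. -/
theorem deficiency_nonneg [Fintype S] [Fintype T] [Nonempty T] (f : V → S) (g : V → T) {P : V → ℝ}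
    (hP : ∀ v, 0 ≤ P v) (h1 : ∑ v, P v = 1) : 0 ≤ deficiency f g P := by
  set Q := fiberMass (fun v => (f v, g v)) P with hQ
  set Q₀ := fiberMass f P with hQ₀
  have hT : (0 : ℝ) < Fintype.card T := by exact_mod_cast Fintype.card_pos
  have key : ∀ v, P v * (1 - (Fintype.card T * (Q (f v, g v) / Q₀ (f v)))⁻¹) ≤
      P v * Real.log (Fintype.card T * (Q (f v, g v) / Q₀ (f v))) := by
    intro v
    rcases (hP v).eq_or_lt with h | h
    · rw [← h, zero_mul, zero_mul]
    · have h2 : 0 < Q (f v, g v) := h.trans_le (le_fiberMass (fun v => (f v, g v)) hP v)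
      have h3 : 0 < Q₀ (f v) := h.trans_le (le_fiberMass f hP v)
      exact mul_le_mul_of_nonneg_left (Real.one_sub_inv_le_log_of_pos (by positivity)) h.le
  have hsum : ∑ v, P v * (Fintype.card T * (Q (f v, g v) / Q₀ (f v)))⁻¹ ≤ 1 := by
    rw [sum_mul_comp_eq (fun v => (f v, g v)) P
      (fun st => (Fintype.card T * (Q st / Q₀ st.1))⁻¹), Fintype.sum_prod_type]
    calc ∑ s, ∑ t, Q (s, t) * (Fintype.card T * (Q (s, t) / Q₀ s))⁻¹
        ≤ ∑ s, ∑ _t : T, Q₀ s * (Fintype.card T : ℝ)⁻¹ := by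
          refine Finset.sum_le_sum fun s _ => Finset.sum_le_sum fun t _ => ?_
          have h0 : 0 ≤ Q₀ s := fiberMass_nonneg f hP s
          rcases eq_or_ne (Q (s, t)) 0 with h | h
          · rw [h, zero_mul]
            positivity
          · rw [mul_inv, inv_div]
            apply le_of_eq
            field_simp
      _ = 1 := by
          simp only [Finset.sum_const, Finset.card_univ, nsmul_eq_mul]
          rw [← Finset.mul_sum, ← Finset.sum_mul, hQ₀, sum_fiberMass, h1]
          field_simp
  have hle := Finset.sum_le_sum fun v (_ : v ∈ Finset.univ) => key v
  simp only [mul_sub, mul_one, Finset.sum_sub_distrib, h1] at hle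
  rw [deficiency]
  simp only [← mul_div_assoc (P _), ← Finset.sum_div]
  exact div_nonneg (by linarith) (Real.log_nonneg (by norm_num))

theorem massEntropy_eq [Fintype S] {v : S → ℝ} (hv : ∀ x, 0 ≤ v x) :
    massEntropy v = ∑ x, v x * (Real.log ((∑ x', v x') / v x) / Real.log 2) := by
  rw [massEntropy, Finset.mul_sum]
  refine Finset.sum_congr rfl fun x _ => ?_
  rcases eq_or_ne (∑ x', v x') 0 with h | h
  · rw [(Finset.sum_eq_zero_iff_of_nonneg fun y _ => hv y).1 h x (Finset.mem_univ x), h]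
    simp
  · rw [Real.negMulLog, ← inv_div (v x), Real.log_inv]
    field_simp

theorem massEntropy_comp_equiv [Fintype S] [Fintype T] (e : S ≃ T) (v : T → ℝ) :
    massEntropy (fun x => v (e x)) = massEntropy v := by
  rw [massEntropy, massEntropy, e.sum_comp v,
    ← e.sum_comp (fun x => Real.negMulLog (v x / ∑ x', v x') / Real.log 2)]

/-- The entropy of `g` given `f` is the mean of `log (Q₀ / Q)`. -/
theorem sum_massEntropy_fiberMass [Fintype S] [Fintype T] [Nonempty T] (f : V → S)
    (g : V → T) {P : V → ℝ} (hP : ∀ v, 0 ≤ P v) (h1 : ∑ v, P v = 1) :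
    ∑ s, massEntropy (fun t => fiberMass (fun v => (f v, g v)) P (s, t)) =
      Real.log (Fintype.card T) / Real.log 2 - deficiency f g P := by
  have hT : (0 : ℝ) < Fintype.card T := by exact_mod_cast Fintype.card_pos
  simp only [massEntropy_eq fun t => fiberMass_nonneg _ hP _, sum_fiberMass_prod]
  rw [← Fintype.sum_prod_type', ← sum_mul_comp_eq (fun v => (f v, g v)) P
    (fun st => Real.log (fiberMass f P st.1 / fiberMass (fun v => (f v, g v)) P st) / Real.log 2),
    eq_sub_iff_add_eq, deficiency, ← Finset.sum_add_distrib]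
  conv_rhs => rw [← one_mul (Real.log _ / _), ← h1, Finset.sum_mul]
  refine Finset.sum_congr rfl fun v _ => ?_
  rcases (hP v).eq_or_lt with h | h
  · simp [← h]
  · have h2 := h.trans_le (le_fiberMass (fun v => (f v, g v)) hP v)
    have h3 := h.trans_le (le_fiberMass f hP v)
    rw [← mul_add, ← add_div, ← Real.log_mul (div_ne_zero h3.ne' h2.ne')
      (mul_ne_zero hT.ne' (div_ne_zero h2.ne' h3.ne'))]
    congr 3
    field_simp

end fiberMass

/-! ### Universal families and privacy amplification -/

/-- A family of maps is universal if every non-zero difference is mapped to zero by the same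
proportion of maps as under a uniformly random map. -/
def IsUniversal {Ω V T : Type} [Fintype Ω] [Fintype T] [AddCommGroup V] [AddCommGroup T]
    (g : Ω → V →+ T) : Prop :=
  ∀ d : V, d ≠ 0 → ({ω | g ω d = 0} : Set Ω).ncard * Fintype.card T = Fintype.card Ω

/-- Subadditivity of `x ^ α` gives `α log (1 + y) ≤ log (1 + y ^ α) ≤ y ^ α`. This trades the
logarithm in the deficiency for a power, whose mean is a Rényi-type moment. -/
theorem log_one_add_le_rpow_div {α y : ℝ} (hα : 0 < α) (hα1 : α ≤ 1) (hy : 0 ≤ y) :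
    Real.log (1 + y) ≤ y ^ α / α := by
  rw [le_div_iff₀ hα, mul_comm, ← Real.log_rpow (by linarith)]
  have h := Real.rpow_add_le_add_rpow zero_le_one hy hα.le hα1
  rw [Real.one_rpow] at h
  have h2 := Real.rpow_nonneg hy α
  calc Real.log ((1 + y) ^ α) ≤ Real.log (1 + y ^ α) :=
        Real.log_le_log (Real.rpow_pos_of_pos (by linarith) _) h
    _ ≤ y ^ α := by linarith [Real.log_le_sub_one_of_pos (show 0 < 1 + y ^ α by linarith)]

/-- The mean of a logarithm is at most the logarithm of a bound for the mean. -/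
theorem sum_log_le {Ω : Type} [Fintype Ω] {x : Ω → ℝ} (hx : ∀ ω, 0 < x ω) {b : ℝ} (hb : 0 < b)
    (h : ∑ ω, x ω ≤ Fintype.card Ω * b) :
    ∑ ω, Real.log (x ω) ≤ Fintype.card Ω * Real.log b := by
  -- The tangent of the logarithm at `b` serves in place of Jensen's inequality.
  have h1 : ∀ ω, Real.log (x ω) ≤ Real.log b + (x ω / b - 1) := fun ω => by
    have := Real.log_le_sub_one_of_pos (div_pos (hx ω) hb)
    rw [Real.log_div (hx ω).ne' hb.ne'] at this
    linarith
  refine (Finset.sum_le_sum fun ω _ => h1 ω).trans ?_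
  rw [Finset.sum_add_distrib, Finset.sum_sub_distrib, ← Finset.sum_div]
  have h2 := (div_le_iff₀ hb).2 h
  simp only [Finset.sum_const, Finset.card_univ, nsmul_eq_mul]
  linarith

section universal

variable {Ω V S T : Type} [Fintype Ω] [Fintype V] [Fintype T] [AddCommGroup V]
  [AddCommGroup S] [AddCommGroup T]

/-- The point `v` always collides with itself, and any other point of its `f`-fiber collides with it
for exactly a fraction `1 / |T|` of the maps. -/
theorem IsUniversal.sum_fiberMass_le {g : Ω → V →+ T} (hg : IsUniversal g) (f : V →+ S)
    {P : V → ℝ} (hP : ∀ v, 0 ≤ P v) (v : V) :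
    ∑ ω, fiberMass (fun v => (f v, g ω v)) P (f v, g ω v) ≤
      Fintype.card Ω * (P v + fiberMass f P (f v) / Fintype.card T) := by
  classical
  have hT : (0 : ℝ) < Fintype.card T := by exact_mod_cast Fintype.card_pos
  have hcount : ∀ w, w ≠ v →
      ∑ ω, (if g ω w = g ω v then P w else 0) = Fintype.card Ω * (P w / Fintype.card T) := by
    intro w hw
    have h := hg (w - v) (sub_ne_zero.2 hw)
    have h2 : ({ω | g ω (w - v) = 0} : Set Ω).ncard =
        (Finset.univ.filter fun ω => g ω w = g ω v).card := by
      rw [← Set.ncard_coe_finset]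
      congr 1
      ext ω
      simp [sub_eq_zero]
    rw [h2] at h
    rw [← Finset.sum_filter, Finset.sum_const, nsmul_eq_mul, ← h]
    push_cast
    field_simp
  calc ∑ ω, fiberMass (fun v => (f v, g ω v)) P (f v, g ω v)
      = ∑ w with f w = f v, ∑ ω, (if g ω w = g ω v then P w else 0) := by
        rw [Finset.sum_comm]
        refine Finset.sum_congr rfl fun ω _ => ?_
        rw [fiberMass, ← Finset.sum_filter, Finset.filter_filter]
        simp only [Prod.mk.injEq]
    _ ≤ ∑ w with f w = f v, ((if w = v then Fintype.card Ω * P v else 0) +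
          Fintype.card Ω * (P w / Fintype.card T)) := by
        refine Finset.sum_le_sum fun w _ => ?_
        split_ifs with h
        · have h0 := hP v
          subst h
          simp only [if_true, Finset.sum_const, Finset.card_univ, nsmul_eq_mul]
          have : 0 ≤ (Fintype.card Ω : ℝ) * (P w / Fintype.card T) := by positivity
          linarith
        · rw [hcount w h, zero_add]
    _ = Fintype.card Ω * (P v + fiberMass f P (f v) / Fintype.card T) := by
        rw [Finset.sum_add_distrib, Finset.sum_ite_eq', if_pos (by simp), fiberMass,
          ← Finset.mul_sum, ← Finset.sum_div, mul_add]

/-- With `Q₀` the fiber mass, split the summand as `P ^ (1/2 + α)` times `P ^ (1/2) Q₀ ^ (-α)` and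
apply Cauchy–Schwarz. The second factor is controlled by Jensen for the concave power `2α ≤ 1` and
by `∑ P / Q₀ ≤ |S|`: the price of revealing `f`. -/
theorem sum_mul_rpow_le {V S : Type} [Fintype V] [Fintype S] (f : V → S)
    {P : V → ℝ} (hP : ∀ v, 0 ≤ P v) (h1 : ∑ v, P v = 1) {α : ℝ} (hα : 0 < α) (hα1 : α ≤ 1 / 2) :
    ∑ v, P v * (P v / fiberMass f P (f v)) ^ α ≤
      √(∑ v, P v ^ (1 + 2 * α)) * (Fintype.card S : ℝ) ^ α := by
  set Q₀ := fiberMass f P with hQ₀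
  have hQ : ∀ s, 0 ≤ Q₀ s := fiberMass_nonneg f hP
  have hinv : ∑ v, P v * (Q₀ (f v))⁻¹ ≤ Fintype.card S := by
    rw [sum_mul_comp_eq f P fun s => (Q₀ s)⁻¹]
    calc ∑ s, Q₀ s * (Q₀ s)⁻¹ ≤ ∑ _s : S, (1 : ℝ) :=
          Finset.sum_le_sum fun s _ => mul_inv_le_one
      _ = Fintype.card S := by simp
  have hjensen : ∑ v, P v * ((Q₀ (f v))⁻¹) ^ (2 * α) ≤ (Fintype.card S : ℝ) ^ (2 * α) := by
    have h := (Real.concaveOn_rpow (p := 2 * α) (by linarith) (by linarith)).le_map_sum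
      (t := Finset.univ) (w := P) (p := fun v => (Q₀ (f v))⁻¹) (fun v _ => hP v) h1
      (fun v _ => Set.mem_Ici.2 (inv_nonneg.2 (hQ _)))
    simp only [smul_eq_mul] at h
    refine h.trans (Real.rpow_le_rpow ?_ hinv (by linarith))
    exact Finset.sum_nonneg fun v _ => mul_nonneg (hP v) (inv_nonneg.2 (hQ _))
  have hcs := Real.sum_mul_le_sqrt_mul_sqrt Finset.univ (fun v => P v ^ (1 / 2 + α))
    (fun v => P v ^ (1 / 2 : ℝ) * ((Q₀ (f v))⁻¹) ^ α)
  have e1 : ∀ v, P v ^ (1 / 2 + α) * (P v ^ (1 / 2 : ℝ) * ((Q₀ (f v))⁻¹) ^ α) =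
      P v * (P v / Q₀ (f v)) ^ α := fun v => by
    rw [← mul_assoc, ← Real.rpow_add_of_nonneg (hP v) (by linarith) (by norm_num),
      div_eq_mul_inv (P v), Real.mul_rpow (hP v) (inv_nonneg.2 (hQ _)), ← mul_assoc]
    congr 1
    rw [show 1 / 2 + α + 1 / 2 = 1 + α by ring,
      Real.rpow_add_of_nonneg (hP v) zero_le_one hα.le, Real.rpow_one]
  have e2 : ∀ v, (P v ^ (1 / 2 + α)) ^ 2 = P v ^ (1 + 2 * α) := fun v => by
    rw [← Real.rpow_natCast, ← Real.rpow_mul (hP v)]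
    congr 1
    push_cast
    ring
  have e3 : ∀ v, (P v ^ (1 / 2 : ℝ) * ((Q₀ (f v))⁻¹) ^ α) ^ 2 =
      P v * ((Q₀ (f v))⁻¹) ^ (2 * α) := fun v => by
    rw [mul_pow, ← Real.rpow_natCast, ← Real.rpow_natCast, ← Real.rpow_mul (hP v),
      ← Real.rpow_mul (inv_nonneg.2 (hQ _))]
    norm_num
    left
    rw [mul_comm]
  simp only [e1, e2, e3] at hcs
  refine hcs.trans (mul_le_mul_of_nonneg_left ?_ (Real.sqrt_nonneg _))
  refine (Real.sqrt_le_sqrt hjensen).trans (le_of_eq ?_)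
  rw [Real.sqrt_eq_rpow, ← Real.rpow_mul (by positivity)]
  congr 1
  ring

/-- Privacy amplification: the mean deficiency under a universal family of hash functions. -/
theorem IsUniversal.sum_deficiency_le [Fintype S] {g : Ω → V →+ T} (hg : IsUniversal g) (f : V →+ S)
    {P : V → ℝ} (hP : ∀ v, 0 ≤ P v) (h1 : ∑ v, P v = 1) {α : ℝ} (hα : 0 < α)
    (hα1 : α ≤ 1 / 2) :
    ∑ ω, deficiency f (g ω) P ≤ Fintype.card Ω * ((Fintype.card T : ℝ) ^ α *
      (Fintype.card S : ℝ) ^ α * √(∑ v, P v ^ (1 + 2 * α)) / (α * Real.log 2)) := by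
  have hT : (0 : ℝ) < Fintype.card T := by exact_mod_cast Fintype.card_pos
  have hl : 0 < Real.log 2 := Real.log_pos (by norm_num)
  set Q₀ := fiberMass f P with hQ₀
  have key : ∀ v, ∑ ω, P v * (Real.log (Fintype.card T *
      (fiberMass (fun v => (f v, g ω v)) P (f v, g ω v) / Q₀ (f v))) / Real.log 2) ≤
      Fintype.card Ω * ((Fintype.card T : ℝ) ^ α / (α * Real.log 2) *
        (P v * (P v / Q₀ (f v)) ^ α)) := by
    intro v
    rcases (hP v).eq_or_lt with h | h
    · simp [← h]
    · have h2 : ∀ ω, 0 < fiberMass (fun v => (f v, g ω v)) P (f v, g ω v) := fun ω =>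
        h.trans_le (le_fiberMass (fun v => (f v, g ω v)) hP v)
      have h3 : 0 < Q₀ (f v) := h.trans_le (le_fiberMass f hP v)
      -- The mean goes inside the logarithm, so only this first moment over the hash is needed.
      have hmean : ∑ ω, (Fintype.card T : ℝ) *
          (fiberMass (fun v => (f v, g ω v)) P (f v, g ω v) / Q₀ (f v)) ≤
          Fintype.card Ω * (1 + Fintype.card T * (P v / Q₀ (f v))) := by
        rw [← Finset.mul_sum, ← Finset.sum_div]
        calc (Fintype.card T : ℝ) *
              ((∑ ω, fiberMass (fun v => (f v, g ω v)) P (f v, g ω v)) / Q₀ (f v))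
            ≤ Fintype.card T *
              ((Fintype.card Ω * (P v + Q₀ (f v) / Fintype.card T)) / Q₀ (f v)) := by
              gcongr
              exact hg.sum_fiberMass_le f hP v
          _ = Fintype.card Ω * (1 + Fintype.card T * (P v / Q₀ (f v))) := by
              field_simp
              ring
      have hlog := sum_log_le (fun ω => mul_pos hT (div_pos (h2 ω) h3)) (by positivity) hmean
      have hlog2 := log_one_add_le_rpow_div hα (by linarith)
        (show 0 ≤ Fintype.card T * (P v / Q₀ (f v)) by positivity)
      rw [Real.mul_rpow hT.le (by positivity)] at hlog2
      rw [← Finset.mul_sum, ← Finset.sum_div]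
      calc P v * ((∑ ω, Real.log (Fintype.card T *
            (fiberMass (fun v => (f v, g ω v)) P (f v, g ω v) / Q₀ (f v)))) / Real.log 2)
          ≤ P v * (Fintype.card Ω * ((Fintype.card T : ℝ) ^ α * (P v / Q₀ (f v)) ^ α / α) /
              Real.log 2) := by
            gcongr
            exact hlog.trans (mul_le_mul_of_nonneg_left hlog2 (by positivity))
        _ = _ := by
            field_simp
  simp only [deficiency]
  rw [Finset.sum_comm]
  refine (Finset.sum_le_sum fun v _ => key v).trans ?_
  rw [← Finset.mul_sum, ← Finset.mul_sum]
  refine mul_le_mul_of_nonneg_left ?_ (by positivity)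
  refine (mul_le_mul_of_nonneg_left (sum_mul_rpow_le f hP h1 hα hα1) (by positivity)).trans
    (le_of_eq ?_)
  ring

/-- A universal family rarely contains a map that is not onto on the kernel of `f`. -/
theorem IsUniversal.ncard_not_onto_mul_le {g : Ω → V →+ T} (hg : IsUniversal g) (f : V →+ S) :
    ({ω | ¬ ∀ x, ∃ c, f c = 0 ∧ g ω c = x} : Set Ω).ncard * Nat.card f.ker ≤
      Fintype.card Ω * Fintype.card T := by
  classical
  set bad : Finset Ω := Finset.univ.filter fun ω => ¬ ∀ x, ∃ c, f c = 0 ∧ g ω c = x with hbad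
  have hb : ({ω | ¬ ∀ x, ∃ c, f c = 0 ∧ g ω c = x} : Set Ω).ncard = bad.card := by
    rw [← Set.ncard_coe_finset]
    congr 1
    ext ω
    simp [hbad]
  -- Count pairs `(ω, c)` with `c ∈ ker f` and `g ω c = 0`. A map not onto on `ker f` has range of
  -- index at least `2`, hence at least twice as many zeros as an onto map.
  have hker : ∀ ω, (1 + if ω ∈ bad then 1 else 0) * Nat.card f.ker ≤
      (∑ c : f.ker, if g ω c = 0 then 1 else 0) * Fintype.card T := by
    intro ω
    set G : f.ker →+ T := (g ω).comp f.ker.subtype with hG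
    have hcard : ∑ c : f.ker, (if g ω c = 0 then 1 else 0) = Nat.card G.ker := by
      rw [Finset.sum_boole, Nat.cast_id, ← Fintype.card_subtype, ← Nat.card_eq_fintype_card]
      rfl
    have hprod : Nat.card G.ker * Nat.card G.range = Nat.card f.ker := by
      rw [← AddSubgroup.index_ker, AddSubgroup.card_mul_index]
    rw [hcard, ← hprod, ← Nat.card_eq_fintype_card, ← AddSubgroup.card_mul_index G.range,
      mul_left_comm]
    refine Nat.mul_le_mul_left _ ?_
    rw [mul_comm]
    refine Nat.mul_le_mul_left _ ?_
    split_ifs with h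
    · by_contra hlt
      have hpos : G.range.index ≠ 0 := AddSubgroup.index_ne_zero_of_finite
      have htop : G.range = ⊤ := AddSubgroup.index_eq_one.1 (by omega)
      refine (Finset.mem_filter.1 h).2 fun x => ?_
      obtain ⟨c, hc⟩ := AddMonoidHom.range_eq_top.1 htop x
      exact ⟨c, c.2, hc⟩
    · exact Nat.one_le_iff_ne_zero.2 AddSubgroup.index_ne_zero_of_finite
  -- Counting by columns, universality fixes the contribution of each `c ≠ 0`; only `c = 0` exceeds
  -- it, which leaves little room for bad maps.
  have hcol : ∀ c : f.ker, (∑ ω, if g ω c = 0 then 1 else 0) * Fintype.card T ≤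
      Fintype.card Ω + if c = 0 then Fintype.card Ω * Fintype.card T else 0 := by
    intro c
    split_ifs with h
    · simp [h]
    · have h2 := hg c (fun h0 => h (Subtype.ext h0))
      rw [Finset.sum_boole, Nat.cast_id, add_zero, ← h2, ← Set.ncard_coe_finset]
      simp
  have h1 := Finset.sum_le_sum fun ω (_ : ω ∈ Finset.univ) => hker ω
  have h2 := Finset.sum_le_sum fun c (_ : c ∈ Finset.univ) => hcol c
  rw [← Finset.sum_mul, ← Finset.sum_mul, Finset.sum_comm] at h1
  rw [← Finset.sum_mul, Finset.sum_add_distrib] at h2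
  have h3 := h1.trans h2
  simp only [Finset.sum_add_distrib, Finset.sum_const, Finset.card_univ, smul_eq_mul, mul_one,
    Finset.sum_ite_mem, Finset.univ_inter, Finset.sum_ite_eq', Finset.mem_univ, if_true,
    ← Nat.card_eq_fintype_card (α := f.ker), add_mul] at h3
  rw [hb]
  linarith [mul_comm (Fintype.card Ω) (Nat.card f.ker)]

end universal

/-! ### Linear hashing -/

/-- Multiplication by a matrix, as a homomorphism of groups. -/
def matrixHom {m n : ℕ} (M : Matrix (Fin m) (Fin n) (ZMod 2)) : Word n →+ Word m :=
  M.mulVecLin.toAddMonoidHom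

theorem matrixHom_apply {m n : ℕ} (M : Matrix (Fin m) (Fin n) (ZMod 2)) (v : Word n) :
    matrixHom M v = M *ᵥ v := rfl

/-- For `d ≠ 0` the homomorphism `M ↦ M d` is onto, since a column at a non-zero entry of `d` can be
prescribed; so its kernel has index `2 ^ m`. -/
theorem isUniversal_matrixHom (m n : ℕ) :
    IsUniversal fun M : Matrix (Fin m) (Fin n) (ZMod 2) => matrixHom M := by
  classical
  intro d hd
  obtain ⟨j, hj⟩ := Function.ne_iff.1 hd
  let ev : Matrix (Fin m) (Fin n) (ZMod 2) →+ Word m :=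
    { toFun := fun M => M *ᵥ d
      map_zero' := Matrix.zero_mulVec d
      map_add' := fun A B => Matrix.add_mulVec A B d }
  have hsurj : Function.Surjective ev := fun t => by
    refine ⟨Matrix.of fun i j' => if j' = j then t i * (d j)⁻¹ else 0, ?_⟩
    funext i
    have : d j ≠ 0 := hj
    simp [ev, Matrix.mulVec, dotProduct, this]
  have h := AddSubgroup.card_mul_index ev.ker
  rw [AddSubgroup.index_ker, AddMonoidHom.range_eq_top.2 hsurj, AddSubgroup.card_top,
    mul_comm] at h
  rw [← Nat.card_eq_fintype_card (α := Word m), ← Nat.card_eq_fintype_card, ← h, mul_comm]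
  rfl

/-! ### The masked message and its syndrome -/

/-- Alice's secret together with the message that carries it, masked by noise of law `P`. -/
def channelLaw {s m n₀ : ℕ} (H₀ : Matrix (Fin s) (Fin n₀) (ZMod 2))
    (H₁ : Matrix (Fin m) (Fin n₀) (ZMod 2)) (P : PMF (Word n₀)) :
    PMF (Word m × Option (Word n₀)) :=
  (PMF.uniformOfFintype (Word m)).bind fun x =>
    ((encode H₀ H₁ x).bind fun c => P.map fun u => c.map fun c => c + u).map fun a => (x, a)

theorem bind_map_prodMk_apply {α β : Type} (p : PMF α) (k : α → PMF β) (x : α) (b : β) :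
    (p.bind fun x => (k x).map fun b => (x, b)) (x, b) = p x * k x b := by
  classical
  rw [PMF.bind_apply, tsum_eq_single x, PMF.map_apply, tsum_eq_single b]
  · simp
  · intro b' hb
    exact if_neg fun h => hb (Prod.ext_iff.1 h).2.symm
  · intro x' hx
    rw [PMF.map_apply, ENNReal.tsum_eq_zero.2, mul_zero]
    intro b'
    exact if_neg fun h => hx (Prod.ext_iff.1 h).1.symm

theorem mem_encodings {s m n₀ : ℕ} {H₀ : Matrix (Fin s) (Fin n₀) (ZMod 2)}
    {H₁ : Matrix (Fin m) (Fin n₀) (ZMod 2)} {x : Word m} {c : Word n₀} :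
    c ∈ encodings H₀ H₁ x ↔ matrixHom H₀ c = 0 ∧ matrixHom H₁ c = x := by
  rw [encodings, Finset.mem_filter, Matrix.fromRows_mulVec, Sum.elim_eq_iff]
  simp [matrixHom_apply]

/-- Every secret has an encoding. -/
def IsOnto {s m n₀ : ℕ} (H₀ : Matrix (Fin s) (Fin n₀) (ZMod 2))
    (H₁ : Matrix (Fin m) (Fin n₀) (ZMod 2)) : Prop :=
  ∀ x, ∃ c, matrixHom H₀ c = 0 ∧ matrixHom H₁ c = x

theorem IsOnto.card_encodings {s m n₀ : ℕ} {H₀ : Matrix (Fin s) (Fin n₀) (ZMod 2)}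
    {H₁ : Matrix (Fin m) (Fin n₀) (ZMod 2)} (h : IsOnto H₀ H₁) (x : Word m) :
    (encodings H₀ H₁ x).card = (encodings H₀ H₁ 0).card := by
  obtain ⟨c, hc0, hc1⟩ := h x
  refine Finset.card_bij' (fun v _ => v - c) (fun v _ => v + c) ?_ ?_ ?_ ?_
  · intro v hv
    rw [mem_encodings] at hv ⊢
    rw [map_sub, map_sub, hv.1, hv.2, hc0, hc1, sub_self, sub_self]
    exact ⟨rfl, rfl⟩
  · intro v hv
    rw [mem_encodings] at hv ⊢
    rw [map_add, map_add, hv.1, hv.2, hc0, hc1, add_zero, zero_add]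
    exact ⟨rfl, rfl⟩
  · intro v _
    exact sub_add_cancel v c
  · intro v _
    exact add_sub_cancel_right v c

theorem IsOnto.card_ker {s m n₀ : ℕ} {H₀ : Matrix (Fin s) (Fin n₀) (ZMod 2)}
    {H₁ : Matrix (Fin m) (Fin n₀) (ZMod 2)} (h : IsOnto H₀ H₁) :
    Nat.card (matrixHom H₀).ker = 2 ^ m * (encodings H₀ H₁ 0).card := by
  classical
  have h1 : Nat.card (matrixHom H₀).ker =
      (Finset.univ.filter fun v => matrixHom H₀ v = 0).card := by
    rw [← Fintype.card_subtype, ← Nat.card_eq_fintype_card]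
    rfl
  rw [h1, Finset.card_eq_sum_card_fiberwise (f := matrixHom H₁) (t := Finset.univ)
    (fun _ _ => Finset.mem_coe.2 (Finset.mem_univ _))]
  have h2 : ∀ x, ((Finset.univ.filter fun v => matrixHom H₀ v = 0).filter
      fun v => matrixHom H₁ v = x) = encodings H₀ H₁ x := fun x => by
    ext v
    rw [mem_encodings]
    simp
  simp only [h2, h.card_encodings]
  rw [Finset.sum_const, smul_eq_mul, Finset.card_univ, Fintype.card_pi]
  simp [ZMod.card]

/-- The noise behind the message `w` is `w - c`. As `c` runs over the encodings of `x`, this runs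
over the words with syndrome `H₀ w` and hash `H₁ w - x`; each `c` has weight `1 / |ker H₀|` jointly
with `x`. -/
theorem IsOnto.channelLaw_apply {s m n₀ : ℕ} {H₀ : Matrix (Fin s) (Fin n₀) (ZMod 2)}
    {H₁ : Matrix (Fin m) (Fin n₀) (ZMod 2)} (h : IsOnto H₀ H₁) (P : PMF (Word n₀)) (x : Word m)
    (w : Word n₀) :
    (channelLaw H₀ H₁ P (x, some w)).toReal = (Nat.card (matrixHom H₀).ker : ℝ)⁻¹ *
      fiberMass (fun v => (matrixHom H₀ v, matrixHom H₁ v)) (fun v => (P v).toReal)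
        (matrixHom H₀ w, matrixHom H₁ w - x) := by
  classical
  have hne : (encodings H₀ H₁ x).Nonempty := by
    obtain ⟨c, hc⟩ := h x
    exact ⟨c, mem_encodings.2 hc⟩
  have hP : ∀ c, (P.map fun u => (some c).map fun c => c + u) (some w) = P (w - c) := by
    intro c
    rw [PMF.map_apply, tsum_eq_single (w - c)]
    · simp
    · intro u hu
      refine if_neg fun he => hu ?_
      simp only [Option.map_some, Option.some.injEq] at he
      rw [he, add_sub_cancel_left]
  rw [channelLaw, bind_map_prodMk_apply, encode, dif_pos hne, PMF.bind_map, PMF.bind_apply,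
    tsum_fintype]
  simp only [Function.comp_apply, hP, PMF.uniformOfFinset_apply, ite_mul, zero_mul]
  rw [Finset.sum_ite_mem, Finset.univ_inter, ← Finset.mul_sum, h.card_encodings,
    PMF.uniformOfFintype_apply, ENNReal.toReal_mul, ENNReal.toReal_mul,
    ENNReal.toReal_sum fun c _ => P.apply_ne_top _, h.card_ker, ← mul_assoc]
  congr 1
  · simp [ZMod.card, mul_comm]
  · refine Finset.sum_bij' (fun c _ => w - c) (fun v _ => w - v) ?_ ?_ ?_ ?_ ?_
    · intro c hc
      rw [mem_encodings] at hc
      simp [hc.1, hc.2]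
    · intro v hv
      rw [mem_encodings]
      simp only [Finset.mem_filter, Finset.mem_univ, true_and, Prod.mk.injEq] at hv
      simp [hv.1, hv.2]
    · intro c _
      exact sub_sub_cancel w c
    · intro c _
      exact sub_sub_cancel w c
    · intro c _
      rfl

theorem IsOnto.channelLaw_apply_none {s m n₀ : ℕ} {H₀ : Matrix (Fin s) (Fin n₀) (ZMod 2)}
    {H₁ : Matrix (Fin m) (Fin n₀) (ZMod 2)} (h : IsOnto H₀ H₁) (P : PMF (Word n₀))
    (x : Word m) : channelLaw H₀ H₁ P (x, none) = 0 := by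
  have hne : (encodings H₀ H₁ x).Nonempty := by
    obtain ⟨c, hc⟩ := h x
    exact ⟨c, mem_encodings.2 hc⟩
  rw [channelLaw, bind_map_prodMk_apply, encode, dif_pos hne, PMF.bind_map]
  refine mul_eq_zero_of_right _ ?_
  rw [PMF.apply_eq_zero_iff]
  simp

theorem sum_toReal_eq_one {α : Type} [Fintype α] (P : PMF α) : ∑ v, (P v).toReal = 1 := by
  rw [← ENNReal.toReal_sum fun v _ => P.apply_ne_top v, ← tsum_fintype (L := .unconditional _),
    P.tsum_coe, ENNReal.toReal_one]

/-- If every secret has an encoding, Bob's uncertainty about it is the entropy of the hash of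
the noise given its syndrome. -/
theorem IsOnto.pairEntropy_channelLaw {s m n₀ : ℕ} {H₀ : Matrix (Fin s) (Fin n₀) (ZMod 2)}
    {H₁ : Matrix (Fin m) (Fin n₀) (ZMod 2)} (h : IsOnto H₀ H₁) (P : PMF (Word n₀)) :
    pairEntropy (channelLaw H₀ H₁ P) =
      m - deficiency (matrixHom H₀) (matrixHom H₁) fun v => (P v).toReal := by
  classical
  have hP : ∀ v, 0 ≤ (P v).toReal := fun v => ENNReal.toReal_nonneg
  set E : Word s → ℝ := fun a => massEntropy fun t =>
    fiberMass (fun v => (matrixHom H₀ v, matrixHom H₁ v)) (fun v => (P v).toReal) (a, t) with hE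
  set K : ℝ := ((Nat.card (matrixHom H₀).ker : ℕ) : ℝ) with hK
  have hK0 : K ≠ 0 := by
    rw [hK]
    exact_mod_cast Nat.card_pos.ne'
  have hsome : ∀ w, massEntropy (fun x => (channelLaw H₀ H₁ P (x, some w)).toReal) =
      K⁻¹ * E (matrixHom H₀ w) := fun w => by
    simp only [h.channelLaw_apply P]
    rw [massEntropy_const_mul]
    congr 1
    exact massEntropy_comp_equiv (Equiv.subLeft (matrixHom H₁ w)) fun t =>
      fiberMass (fun v => (matrixHom H₀ v, matrixHom H₁ v)) (fun v => (P v).toReal)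
        (matrixHom H₀ w, t)
  -- A non-empty fiber of `H₀` is a coset of the kernel, of size `K`; over an empty one `E`
  -- vanishes.
  have hfib : ∀ a, fiberMass (matrixHom H₀) (fun _ => 1) a * E a = K * E a := by
    intro a
    by_cases ha : ∃ w, matrixHom H₀ w = a
    · obtain ⟨w, rfl⟩ := ha
      congr 1
      rw [fiberMass, Finset.sum_const, nsmul_eq_mul, mul_one, hK, Nat.cast_inj]
      have : Nat.card (matrixHom H₀).ker =
          (Finset.univ.filter fun v => matrixHom H₀ v = 0).card := by
        rw [← Fintype.card_subtype, ← Nat.card_eq_fintype_card]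
        rfl
      rw [this]
      refine Finset.card_bij' (fun v _ => v - w) (fun v _ => v + w) ?_ ?_ ?_ ?_ <;>
        simp +contextual
    · have : E a = 0 := by
        rw [hE, ← massEntropy_zero (α := Word m)]
        refine congrArg massEntropy (funext fun t => ?_)
        exact fiberMass_eq_zero _ _ fun v hv => ha ⟨v, (Prod.ext_iff.1 hv).1⟩
      rw [this, mul_zero, mul_zero]
  rw [pairEntropy, Fintype.sum_option]
  simp only [h.channelLaw_apply_none, ENNReal.toReal_zero, massEntropy_zero, hsome, zero_add]
  have hsum := sum_mul_comp_eq (matrixHom H₀) (fun _ => 1) E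
  simp only [hfib, one_mul, ← Finset.mul_sum] at hsum
  rw [← Finset.mul_sum, hsum, inv_mul_cancel_left₀ hK0,
    sum_massEntropy_fiberMass (matrixHom H₀) (matrixHom H₁) hP (sum_toReal_eq_one P)]
  congr 1
  rw [div_eq_iff (Real.log_pos (by norm_num)).ne', ← Real.log_pow]
  simp [ZMod.card]

/-! ### Bob's view -/

/-- The law of the word `r_I` given the received pairs. -/
def wordPosterior (φ : unitInterval) {n₀ : ℕ} (z : Received n₀) (I : Partition n₀)
    (σ : Equiv.Perm (Fin n₀)) : PMF (Word n₀) :=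
  independent fun j => posterior φ (z ((I : Finset (Fin (2 * n₀))).orderEmbOfFin I.2 (σ j)))

/-- The positions of `I` and `J`, in the order in which Alice uses them. -/
def positionEquiv {n₀ : ℕ} (I : Partition n₀) (σ τ : Equiv.Perm (Fin n₀)) :
    Fin n₀ ⊕ Fin n₀ ≃ Fin (2 * n₀) :=
  Equiv.ofBijective
    (Sum.elim (fun j => (I : Finset (Fin (2 * n₀))).orderEmbOfFin I.2 (σ j))
      (fun j => (I.compl : Finset (Fin (2 * n₀))).orderEmbOfFin I.compl.2 (τ j))) (by
    rw [Fintype.bijective_iff_injective_and_card]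
    refine ⟨Function.Injective.sumElim ?_ ?_ ?_, ?_⟩
    · exact (Finset.orderEmbOfFin _ _).injective.comp σ.injective
    · exact (Finset.orderEmbOfFin _ _).injective.comp τ.injective
    · intro a b hab
      have h1 := Finset.orderEmbOfFin_mem (I : Finset (Fin (2 * n₀))) I.2 (σ a)
      have h2 := Finset.orderEmbOfFin_mem (I.compl : Finset (Fin (2 * n₀))) I.compl.2 (τ b)
      rw [← hab] at h2
      exact Finset.mem_compl.1 h2 h1
    · simp [two_mul])

/-- Given the received pairs, the two words `r_I` and `r_J` are independent. -/
theorem independent_posterior_bind {γ : Type} (φ : unitInterval) {n₀ : ℕ} (z : Received n₀)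
    (I : Partition n₀) (σ τ : Equiv.Perm (Fin n₀)) (F : Word n₀ → Word n₀ → PMF γ) :
    ((independent fun i => posterior φ (z i)).bind fun r =>
        F (restrict r I σ) (restrict r I.compl τ)) =
      (wordPosterior φ z I σ).bind fun u => (wordPosterior φ z I.compl τ).bind fun v => F u v :=
  independent_bind_split (positionEquiv I σ τ) (fun i => posterior φ (z i)) F

/-- The joint law of the secret and Bob's view, for given received pairs and partition. -/
def viewLaw (φ : unitInterval) {s m n₀ : ℕ} (H₀ : Matrix (Fin s) (Fin n₀) (ZMod 2))
    (H₁ : Matrix (Fin m) (Fin n₀) (ZMod 2)) (z : Received n₀) (I : Partition n₀)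
    (σ τ : Equiv.Perm (Fin n₀)) : PMF (Word m × View m n₀) :=
  (channelLaw H₀ H₁ (wordPosterior φ z I σ)).bind fun xa =>
    (channelLaw H₀ H₁ (wordPosterior φ z I.compl τ)).bind fun yb =>
      PMF.pure (if erasures z I.compl ≤ erasures z I then xa.1 else yb.1,
        (H₁, z, I, σ, τ, xa.2, yb.2))

theorem channelLaw_bind {γ : Type} {s m n₀ : ℕ} (H₀ : Matrix (Fin s) (Fin n₀) (ZMod 2))
    (H₁ : Matrix (Fin m) (Fin n₀) (ZMod 2)) (P : PMF (Word n₀))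
    (F : Word m × Option (Word n₀) → PMF γ) :
    (channelLaw H₀ H₁ P).bind F = P.bind fun u => (PMF.uniformOfFintype (Word m)).bind fun x =>
      (encode H₀ H₁ x).bind fun c => F (x, c.map fun c => c + u) := by
  rw [channelLaw, PMF.bind_bind, PMF.bind_comm P]
  refine congrArg (PMF.bind _) (funext fun x => ?_)
  rw [PMF.bind_map, PMF.bind_bind, PMF.bind_comm P]
  refine congrArg (PMF.bind _) (funext fun c => ?_)
  rw [PMF.bind_map]
  rfl

/-- The partition depends on `H₁` and `z` alone, so Alice's bits can be drawn from their posterior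
after the partition and the permutations. This removes Bob's strategy from the law of the words. -/
theorem map_protocolGiven (φ : unitInterval) {s m n₀ : ℕ}
    (H₀ : Matrix (Fin s) (Fin n₀) (ZMod 2)) (bob : Strategy m n₀)
    (H₁ : Matrix (Fin m) (Fin n₀) (ZMod 2)) :
    (protocolGiven φ H₀ bob H₁).map (fun ω => (ω.noisierSecret, ω.view)) =
      (receivedLaw φ n₀).bind fun z => (bob H₁ z).bind fun I =>
        (PMF.uniformOfFintype (Equiv.Perm (Fin n₀))).bind fun σ =>
          (PMF.uniformOfFintype (Equiv.Perm (Fin n₀))).bind fun τ => viewLaw φ H₀ H₁ z I σ τ := by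
  simp only [protocolGiven, PMF.map_bind, PMF.pure_map, Run.noisierSecret, Run.view]
  set G : Received n₀ → Partition n₀ → Equiv.Perm (Fin n₀) → Equiv.Perm (Fin n₀) →
      Word n₀ → Word n₀ → PMF (Word m × View m n₀) := fun z I σ τ u v =>
    (PMF.uniformOfFintype (Word m)).bind fun x => (encode H₀ H₁ x).bind fun cx =>
      (PMF.uniformOfFintype (Word m)).bind fun y => (encode H₀ H₁ y).bind fun cy =>
        PMF.pure (if erasures z I.compl ≤ erasures z I then x else y,
          (H₁, z, I, σ, τ, cx.map fun c => c + u, cy.map fun c => c + v)) with hG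
  have h1 : ∀ z I σ τ, viewLaw φ H₀ H₁ z I σ τ =
      (wordPosterior φ z I σ).bind fun u => (wordPosterior φ z I.compl τ).bind fun v =>
        G z I σ τ u v := by
    intro z I σ τ
    simp only [viewLaw, channelLaw_bind, hG]
    refine congrArg (PMF.bind _) (funext fun u => ?_)
    symm
    rw [PMF.bind_comm]
    refine congrArg (PMF.bind _) (funext fun x => ?_)
    rw [PMF.bind_comm]
  have h2 : ∀ z, ((bob H₁ z).bind fun I =>
        (PMF.uniformOfFintype (Equiv.Perm (Fin n₀))).bind fun σ =>
          (PMF.uniformOfFintype (Equiv.Perm (Fin n₀))).bind fun τ => viewLaw φ H₀ H₁ z I σ τ) =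
      (independent fun i => posterior φ (z i)).bind fun r => (bob H₁ z).bind fun I =>
        (PMF.uniformOfFintype (Equiv.Perm (Fin n₀))).bind fun σ =>
          (PMF.uniformOfFintype (Equiv.Perm (Fin n₀))).bind fun τ =>
            G z I σ τ (restrict r I σ) (restrict r I.compl τ) := by
    intro z
    symm
    rw [PMF.bind_comm]
    refine congrArg (PMF.bind _) (funext fun I => ?_)
    rw [PMF.bind_comm]
    refine congrArg (PMF.bind _) (funext fun σ => ?_)
    rw [PMF.bind_comm]
    refine congrArg (PMF.bind _) (funext fun τ => ?_)
    rw [independent_posterior_bind φ z I σ τ (G z I σ τ), h1]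
  simp only [h2]
  rw [← uniform_bind_transmit φ fun r z => (bob H₁ z).bind fun I =>
        (PMF.uniformOfFintype (Equiv.Perm (Fin n₀))).bind fun σ =>
          (PMF.uniformOfFintype (Equiv.Perm (Fin n₀))).bind fun τ =>
            G z I σ τ (restrict r I σ) (restrict r I.compl τ)]
  -- The swaps from here on carry both secrets inward past `r`, `z`, `I`, `σ`, `τ`, and finally `y`
  -- past `cx`.
  rw [PMF.bind_comm]
  conv_lhs =>
    enter [2, y]
    rw [PMF.bind_comm]
  rw [PMF.bind_comm]
  refine congrArg (PMF.bind _) (funext fun r => ?_)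
  conv_lhs =>
    enter [2, y]
    rw [PMF.bind_comm]
  rw [PMF.bind_comm]
  refine congrArg (PMF.bind _) (funext fun z => ?_)
  conv_lhs =>
    enter [2, y]
    rw [PMF.bind_comm]
  rw [PMF.bind_comm]
  refine congrArg (PMF.bind _) (funext fun I => ?_)
  conv_lhs =>
    enter [2, y]
    rw [PMF.bind_comm]
  rw [PMF.bind_comm]
  refine congrArg (PMF.bind _) (funext fun σ => ?_)
  conv_lhs =>
    enter [2, y]
    rw [PMF.bind_comm]
  rw [PMF.bind_comm]
  refine congrArg (PMF.bind _) (funext fun τ => ?_)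
  rw [PMF.bind_comm]
  refine congrArg (PMF.bind _) (funext fun x => ?_)
  rw [PMF.bind_comm]

/-- Independent additional information does not change the entropy. -/
theorem pairEntropy_bind_map {α β γ δ : Type} [Fintype α] [Fintype β] [Fintype γ] [Fintype δ]
    (μ : PMF (α × β)) (ν : PMF δ) (f : δ → β → γ) (label : γ → δ)
    (hl : ∀ d b, label (f d b) = d) (hf : ∀ d, Function.Injective (f d)) :
    pairEntropy (ν.bind fun d => μ.map fun a => (a.1, f d a.2)) = pairEntropy μ := by
  rw [pairEntropy_bind _ _ label]
  · simp only [pairEntropy_map_of_injective μ (hf _)]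
    rw [← Finset.sum_mul, sum_toReal_eq_one, one_mul]
  · intro d x o h
    rw [← PMF.mem_support_iff, PMF.mem_support_map_iff] at h
    obtain ⟨a, -, ha⟩ := h
    rw [← show f d a.2 = o from (Prod.ext_iff.1 ha).2, hl]

/-- With `z`, `I`, `σ`, `τ` fixed, the message carrying the other secret is independent of the
noisier secret and its message, and so can be discarded. -/
theorem pairEntropy_viewLaw (φ : unitInterval) {s m n₀ : ℕ}
    (H₀ : Matrix (Fin s) (Fin n₀) (ZMod 2)) (H₁ : Matrix (Fin m) (Fin n₀) (ZMod 2))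
    (z : Received n₀) (I : Partition n₀) (σ τ : Equiv.Perm (Fin n₀)) :
    pairEntropy (viewLaw φ H₀ H₁ z I σ τ) =
      if erasures z I.compl ≤ erasures z I then
        pairEntropy (channelLaw H₀ H₁ (wordPosterior φ z I σ))
      else pairEntropy (channelLaw H₀ H₁ (wordPosterior φ z I.compl τ)) := by
  split_ifs with h
  · rw [← pairEntropy_bind_map (channelLaw H₀ H₁ (wordPosterior φ z I σ))
      ((channelLaw H₀ H₁ (wordPosterior φ z I.compl τ)).map Prod.snd)
      (fun b a => ((H₁, z, I, σ, τ, a, b) : View m n₀)) (fun o => o.2.2.2.2.2.2)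
      (fun _ _ => rfl) (fun b a a' haa => by simpa using haa)]
    rw [viewLaw, PMF.bind_map, PMF.bind_comm]
    simp only [if_pos h, ← PMF.bind_pure_comp]
    rfl
  · rw [← pairEntropy_bind_map (channelLaw H₀ H₁ (wordPosterior φ z I.compl τ))
      ((channelLaw H₀ H₁ (wordPosterior φ z I σ)).map Prod.snd)
      (fun a b => ((H₁, z, I, σ, τ, a, b) : View m n₀)) (fun o => o.2.2.2.2.2.1)
      (fun _ _ => rfl) (fun b a a' haa => by simpa using haa)]
    rw [viewLaw, PMF.bind_map]
    simp only [if_neg h, ← PMF.bind_pure_comp]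
    rfl

/-- All of `z`, `I`, `σ`, `τ` are visible in Bob's view, so the conditional entropy is exactly an
average over them. -/
theorem condEntropy_protocolGiven (φ : unitInterval) {s m n₀ : ℕ}
    (H₀ : Matrix (Fin s) (Fin n₀) (ZMod 2)) (bob : Strategy m n₀)
    (H₁ : Matrix (Fin m) (Fin n₀) (ZMod 2)) :
    condEntropy (protocolGiven φ H₀ bob H₁) Run.noisierSecret Run.view =
      ∑ z, (receivedLaw φ n₀ z).toReal * ∑ I, (bob H₁ z I).toReal *
        ∑ σ, (PMF.uniformOfFintype (Equiv.Perm (Fin n₀)) σ).toReal *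
          ∑ τ, (PMF.uniformOfFintype (Equiv.Perm (Fin n₀)) τ).toReal *
            pairEntropy (viewLaw φ H₀ H₁ z I σ τ) := by
  rw [condEntropy_eq_pairEntropy, map_protocolGiven, pairEntropy_bind _ _ fun o => o.2.1]
  · refine Finset.sum_congr rfl fun z _ => congrArg _ ?_
    rw [pairEntropy_bind _ _ fun o => o.2.2.1]
    · refine Finset.sum_congr rfl fun I _ => congrArg _ ?_
      rw [pairEntropy_bind _ _ fun o => o.2.2.2.1]
      · refine Finset.sum_congr rfl fun σ _ => congrArg _ ?_
        rw [pairEntropy_bind _ _ fun o => o.2.2.2.2.1]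
        intro τ x o h
        simp only [← PMF.mem_support_iff, viewLaw, PMF.mem_support_bind_iff,
          PMF.mem_support_pure_iff, Prod.mk.injEq] at h
        obtain ⟨_, _, _, _, _, rfl⟩ := h
        rfl
      · intro σ x o h
        simp only [← PMF.mem_support_iff, viewLaw, PMF.mem_support_bind_iff,
          PMF.mem_support_pure_iff, Prod.mk.injEq] at h
        obtain ⟨_, _, _, _, _, _, _, rfl⟩ := h
        rfl
    · intro I x o h
      simp only [← PMF.mem_support_iff, viewLaw, PMF.mem_support_bind_iff,
        PMF.mem_support_pure_iff, Prod.mk.injEq] at h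
      obtain ⟨_, _, _, _, _, _, _, _, _, rfl⟩ := h
      rfl
  · intro z x o h
    simp only [← PMF.mem_support_iff, viewLaw, PMF.mem_support_bind_iff,
      PMF.mem_support_pure_iff, Prod.mk.injEq] at h
    obtain ⟨_, _, _, _, _, _, _, _, _, _, _, rfl⟩ := h
    rfl

/-- The entropy for a public random hash matrix is the mean over the matrix. -/
theorem condEntropy_protocol (φ : unitInterval) {s m n₀ : ℕ}
    (H₀ : Matrix (Fin s) (Fin n₀) (ZMod 2)) (bob : Strategy m n₀) :
    condEntropy (protocol φ H₀ bob) Run.noisierSecret Run.view =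
      ∑ H₁, (PMF.uniformOfFintype (Matrix (Fin m) (Fin n₀) (ZMod 2)) H₁).toReal *
        condEntropy (protocolGiven φ H₀ bob H₁) Run.noisierSecret Run.view := by
  simp only [condEntropy_eq_pairEntropy]
  rw [protocol, PMF.map_bind, pairEntropy_bind _ _ fun o => o.1]
  intro H₁ x o h
  rw [map_protocolGiven] at h
  simp only [← PMF.mem_support_iff, viewLaw, PMF.mem_support_bind_iff,
    PMF.mem_support_pure_iff, Prod.mk.injEq] at h
  obtain ⟨_, _, _, _, _, _, _, _, _, _, _, _, _, rfl⟩ := h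
  rfl

/-! ### The noise -/

/-- The law of the noise on a word with the given erasure pattern. -/
def noiseLaw (p : unitInterval) {n : ℕ} (e : Fin n → Bool) : PMF (Word n) :=
  independent fun j => noise p (e j)

/-- The erasure pattern of a word `r_I`. -/
def erasurePattern {n₀ : ℕ} (z : Received n₀) (I : Partition n₀) (j : Fin n₀) : Bool :=
  erased (z ((I : Finset (Fin (2 * n₀))).orderEmbOfFin I.2 j))

/-- A known shift of the noise merely shifts the message. It serves to remove the received bits from
the posterior and leave pure noise. -/
theorem channelLaw_map_add {s m n₀ : ℕ} (H₀ : Matrix (Fin s) (Fin n₀) (ZMod 2))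
    (H₁ : Matrix (Fin m) (Fin n₀) (ZMod 2)) (P : PMF (Word n₀)) (t : Word n₀) :
    channelLaw H₀ H₁ (P.map fun u => u + t) =
      (channelLaw H₀ H₁ P).map fun a => (a.1, a.2.map fun c => c + t) := by
  rw [← PMF.bind_pure_comp _ (channelLaw H₀ H₁ P),
    ← PMF.bind_pure (channelLaw H₀ H₁ (P.map fun u => u + t)),
    channelLaw_bind, channelLaw_bind, PMF.bind_map]
  refine congrArg (PMF.bind _) (funext fun u => ?_)
  refine congrArg (PMF.bind _) (funext fun x => ?_)
  refine congrArg (PMF.bind _) (funext fun c => ?_)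
  simp only [Function.comp_apply, Option.map_map]
  congr 3
  funext c
  exact (add_assoc c u t).symm

/-- Only the erasure pattern of the received word matters to Bob's uncertainty. -/
theorem pairEntropy_channelLaw_wordPosterior (φ : unitInterval) {s m n₀ : ℕ}
    (H₀ : Matrix (Fin s) (Fin n₀) (ZMod 2)) (H₁ : Matrix (Fin m) (Fin n₀) (ZMod 2))
    (z : Received n₀) (I : Partition n₀) (σ : Equiv.Perm (Fin n₀)) :
    pairEntropy (channelLaw H₀ H₁ (wordPosterior φ z I σ)) =
      pairEntropy (channelLaw H₀ H₁
        (noiseLaw (residualCrossover φ) fun j => erasurePattern z I (σ j))) := by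
  have h : wordPosterior φ z I σ =
      (noiseLaw (residualCrossover φ) fun j => erasurePattern z I (σ j)).map fun u =>
        u + fun j => (z ((I : Finset (Fin (2 * n₀))).orderEmbOfFin I.2 (σ j))).1 := by
    rw [noiseLaw, wordPosterior]
    exact (independent_map _ fun j b =>
      b + (z ((I : Finset (Fin (2 * n₀))).orderEmbOfFin I.2 (σ j))).1).symm
  rw [h, channelLaw_map_add]
  exact pairEntropy_map_of_injective _ (Option.map_injective (add_left_injective _))

/-- The number of erasures of a pattern. -/
def weight {n : ℕ} (e : Fin n → Bool) : ℕ := Fintype.card {j // e j = true}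

theorem weight_erasurePattern {n₀ : ℕ} (z : Received n₀) (I : Partition n₀) :
    weight (erasurePattern z I) = erasures z I := by
  rw [weight, Fintype.card_subtype, erasures]
  refine Finset.card_bij (fun j _ => (I : Finset (Fin (2 * n₀))).orderEmbOfFin I.2 j) ?_ ?_ ?_
  · intro j hj
    rw [Finset.mem_filter] at hj ⊢
    exact ⟨Finset.orderEmbOfFin_mem _ _ _, of_decide_eq_true hj.2⟩
  · intro j _ j' _ h
    exact (Finset.orderEmbOfFin _ _).injective h
  · intro i hi
    rw [Finset.mem_filter] at hi
    have h : i ∈ Set.range ((I : Finset (Fin (2 * n₀))).orderEmbOfFin I.2) := by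
      rw [Finset.range_orderEmbOfFin]
      exact hi.1
    obtain ⟨j, rfl⟩ := h
    exact ⟨j, Finset.mem_filter.2 ⟨Finset.mem_univ _, decide_eq_true hi.2⟩, rfl⟩

theorem weight_le {n : ℕ} (e : Fin n → Bool) : weight e ≤ n := by
  simpa [weight] using Fintype.card_subtype_le fun j => e j = true

/-- The sum over all rearrangements of a pattern depends on its weight only. -/
theorem sum_perm_eq_of_weight_eq {n : ℕ} {e e' : Fin n → Bool} (h : weight e = weight e')
    (Φ : (Fin n → Bool) → ℝ) :
    ∑ σ : Equiv.Perm (Fin n), Φ (fun j => e (σ j)) =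
      ∑ σ : Equiv.Perm (Fin n), Φ (fun j => e' (σ j)) := by
  -- A bijection between the erased positions extends to a permutation, which the sum over `σ`
  -- absorbs.
  have f : {j // e j = true} ≃ {j // e' j = true} := Fintype.equivOfCardEq h
  have hf : ∀ j, e' (f.extendSubtype j) = e j := by
    intro j
    by_cases hj : e j = true
    · rw [hj, f.extendSubtype_mem j hj]
    · rw [Bool.eq_false_iff.2 hj, Bool.eq_false_iff.2 (f.extendSubtype_not_mem j hj)]
  symm
  rw [← Equiv.sum_comp (Equiv.mulLeft f.extendSubtype)]
  refine Finset.sum_congr rfl fun σ _ => congrArg Φ (funext fun j => ?_)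
  exact hf (σ j)

/-- The pattern whose erasures are the first `e` positions. -/
def initialPattern (n e : ℕ) (j : Fin n) : Bool := decide ((j : ℕ) < e)

theorem weight_initialPattern {n e : ℕ} (h : e ≤ n) : weight (initialPattern n e) = e := by
  rw [weight, Fintype.card_subtype]
  simp only [initialPattern, decide_eq_true_eq]
  rw [Fin.card_filter_val_lt, min_eq_right h]

/-! ### Bob's information -/

/-- The deficiency of the hash of the noise, averaged over the permutation of a pattern with `e`
erasures. -/
def meanDeficiency (p : unitInterval) {s m n : ℕ} (H₀ : Matrix (Fin s) (Fin n) (ZMod 2))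
    (H₁ : Matrix (Fin m) (Fin n) (ZMod 2)) (e : ℕ) : ℝ :=
  ∑ σ, (PMF.uniformOfFintype (Equiv.Perm (Fin n)) σ).toReal *
    deficiency (matrixHom H₀) (matrixHom H₁)
      fun v => (noiseLaw p (fun j => initialPattern n e (σ j)) v).toReal

/-- The number of erasures among all received pairs. -/
def totalErasures {n₀ : ℕ} (z : Received n₀) : ℕ :=
  (Finset.univ.filter fun i => erased (z i) = true).card

open Classical in
/-- A bound for the number of bits that Bob learns with a given hash matrix, whatever his
partition. -/
def loss (φ : unitInterval) {s m n₀ : ℕ} (H₀ : Matrix (Fin s) (Fin n₀) (ZMod 2))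
    (H₁ : Matrix (Fin m) (Fin n₀) (ZMod 2)) : ℝ :=
  (if IsOnto H₀ H₁ then 0 else (m : ℝ)) + ∑ z, (receivedLaw φ n₀ z).toReal *
    ∑ e ∈ (Finset.range (n₀ + 1)).filter fun e => totalErasures z ≤ 2 * e,
      meanDeficiency (residualCrossover φ) H₀ H₁ e

theorem noiseDeficiency_nonneg {s m n : ℕ} (H₀ : Matrix (Fin s) (Fin n) (ZMod 2))
    (H₁ : Matrix (Fin m) (Fin n) (ZMod 2)) (P : PMF (Word n)) :
    0 ≤ deficiency (matrixHom H₀) (matrixHom H₁) fun v => (P v).toReal :=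
  deficiency_nonneg _ _ (fun _ => ENNReal.toReal_nonneg) (sum_toReal_eq_one P)

theorem meanDeficiency_nonneg (p : unitInterval) {s m n : ℕ}
    (H₀ : Matrix (Fin s) (Fin n) (ZMod 2)) (H₁ : Matrix (Fin m) (Fin n) (ZMod 2)) (e : ℕ) :
    0 ≤ meanDeficiency p H₀ H₁ e :=
  Finset.sum_nonneg fun _ _ => mul_nonneg ENNReal.toReal_nonneg (noiseDeficiency_nonneg _ _ _)

theorem loss_nonneg (φ : unitInterval) {s m n₀ : ℕ} (H₀ : Matrix (Fin s) (Fin n₀) (ZMod 2))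
    (H₁ : Matrix (Fin m) (Fin n₀) (ZMod 2)) : 0 ≤ loss φ H₀ H₁ := by
  refine add_nonneg (by split_ifs <;> positivity) (Finset.sum_nonneg fun z _ => ?_)
  exact mul_nonneg ENNReal.toReal_nonneg
    (Finset.sum_nonneg fun e _ => meanDeficiency_nonneg _ _ _ _)

-- When some secret has no encoding, all `m` bits are given up and the bound is trivial.
open Classical in
theorem le_pairEntropy_channelLaw {s m n₀ : ℕ} (H₀ : Matrix (Fin s) (Fin n₀) (ZMod 2))
    (H₁ : Matrix (Fin m) (Fin n₀) (ZMod 2)) (P : PMF (Word n₀)) :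
    m - (if IsOnto H₀ H₁ then 0 else (m : ℝ)) -
      (deficiency (matrixHom H₀) (matrixHom H₁) fun v => (P v).toReal) ≤
        pairEntropy (channelLaw H₀ H₁ P) := by
  split_ifs with h
  · rw [h.pairEntropy_channelLaw, sub_zero]
  · linarith [noiseDeficiency_nonneg H₀ H₁ P, pairEntropy_nonneg (channelLaw H₀ H₁ P)]

-- The mean over `σ` allows Bob's erasure pattern to be replaced by the initial pattern of the same
-- weight, so his choice enters only through a number.
open Classical in
theorem le_mean_pairEntropy_channelLaw (φ : unitInterval) {s m n₀ : ℕ}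
    (H₀ : Matrix (Fin s) (Fin n₀) (ZMod 2)) (H₁ : Matrix (Fin m) (Fin n₀) (ZMod 2))
    (z : Received n₀) (I : Partition n₀) :
    m - (if IsOnto H₀ H₁ then 0 else (m : ℝ)) -
      meanDeficiency (residualCrossover φ) H₀ H₁ (erasures z I) ≤
        ∑ σ, (PMF.uniformOfFintype (Equiv.Perm (Fin n₀)) σ).toReal *
          pairEntropy (channelLaw H₀ H₁ (wordPosterior φ z I σ)) := by
  have hw : weight (initialPattern n₀ (erasures z I)) = weight (erasurePattern z I) := by
    rw [weight_erasurePattern, weight_initialPattern]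
    rw [← weight_erasurePattern]
    exact weight_le _
  have h1 : meanDeficiency (residualCrossover φ) H₀ H₁ (erasures z I) =
      ∑ σ, (PMF.uniformOfFintype (Equiv.Perm (Fin n₀)) σ).toReal *
        deficiency (matrixHom H₀) (matrixHom H₁) fun v => (noiseLaw (residualCrossover φ)
          (fun j => erasurePattern z I (σ j)) v).toReal := by
    simp only [meanDeficiency, PMF.uniformOfFintype_apply, ← Finset.mul_sum]
    congr 1
    exact sum_perm_eq_of_weight_eq hw fun e =>
      deficiency (matrixHom H₀) (matrixHom H₁) fun v => (noiseLaw (residualCrossover φ) e v).toReal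
  rw [h1, ← one_mul ((m : ℝ) - _),
    ← sum_toReal_eq_one (PMF.uniformOfFintype (Equiv.Perm (Fin n₀))), Finset.sum_mul,
    ← Finset.sum_sub_distrib]
  refine Finset.sum_le_sum fun σ _ => ?_
  rw [← mul_sub, pairEntropy_channelLaw_wordPosterior]
  exact mul_le_mul_of_nonneg_left (le_pairEntropy_channelLaw H₀ H₁ _) ENNReal.toReal_nonneg

theorem erasures_add_erasures_compl {n₀ : ℕ} (z : Received n₀) (I : Partition n₀) :
    erasures z I + erasures z I.compl = totalErasures z := by
  rw [erasures, erasures, totalErasures, Partition.compl]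
  rw [← Finset.card_union_of_disjoint]
  · rw [← Finset.filter_union, Finset.union_compl]
    simp [erased]
  · exact Finset.disjoint_filter_filter disjoint_compl_right

theorem erasures_le {n₀ : ℕ} (z : Received n₀) (I : Partition n₀) : erasures z I ≤ n₀ := by
  rw [← weight_erasurePattern]
  exact weight_le _

/-- Bob's uncertainty, for every strategy. -/
theorem le_condEntropy_protocolGiven (φ : unitInterval) {s m n₀ : ℕ}
    (H₀ : Matrix (Fin s) (Fin n₀) (ZMod 2)) (bob : Strategy m n₀)
    (H₁ : Matrix (Fin m) (Fin n₀) (ZMod 2)) :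
    m - loss φ H₀ H₁ ≤
      condEntropy (protocolGiven φ H₀ bob H₁) Run.noisierSecret Run.view := by
  classical
  rw [condEntropy_protocolGiven, loss, ← sub_sub]
  set M : ℝ := m - (if IsOnto H₀ H₁ then 0 else (m : ℝ)) with hM
  rw [← one_mul M, ← sum_toReal_eq_one (receivedLaw φ n₀), Finset.sum_mul,
    ← Finset.sum_sub_distrib]
  refine Finset.sum_le_sum fun z _ => ?_
  rw [← mul_sub]
  refine mul_le_mul_of_nonneg_left ?_ ENNReal.toReal_nonneg
  set B := ∑ e ∈ (Finset.range (n₀ + 1)).filter fun e => totalErasures z ≤ 2 * e,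
      meanDeficiency (residualCrossover φ) H₀ H₁ e with hB
  rw [← one_mul (M - B), ← sum_toReal_eq_one (bob H₁ z), Finset.sum_mul]
  refine Finset.sum_le_sum fun I _ => ?_
  refine mul_le_mul_of_nonneg_left ?_ ENNReal.toReal_nonneg
  -- The noisier half holds at least half of the erasures, ties included, so its deficiency is one
  -- term of the non-negative sum `B`, whichever partition Bob picks.
  have hle : ∀ I' : Partition n₀, totalErasures z ≤ 2 * erasures z I' →
      meanDeficiency (residualCrossover φ) H₀ H₁ (erasures z I') ≤ B := by
    intro I' h
    refine Finset.single_le_sum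
      (f := fun e => meanDeficiency (residualCrossover φ) H₀ H₁ e)
      (fun e _ => meanDeficiency_nonneg _ H₀ H₁ e) ?_
    rw [Finset.mem_filter, Finset.mem_range]
    exact ⟨Nat.lt_succ_of_le (erasures_le z I'), h⟩
  have htot := erasures_add_erasures_compl z I
  simp only [pairEntropy_viewLaw]
  split_ifs with h
  · simp only [← Finset.sum_mul, sum_toReal_eq_one, one_mul]
    refine le_trans ?_ (le_mean_pairEntropy_channelLaw φ H₀ H₁ z I)
    linarith [hle I (by omega)]
  · rw [← Finset.sum_mul, sum_toReal_eq_one, one_mul]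
    refine le_trans ?_ (le_mean_pairEntropy_channelLaw φ H₀ H₁ z I.compl)
    linarith [hle I.compl (by omega)]

/-! ### The mean loss -/

/-- The contribution of an erased position to the mean loss. -/
def erasedFactor (α : ℝ) : ℝ := ((2 : ℝ) ^ (-(2 * α))) ^ (1 / 4 : ℝ)

/-- The contribution of a position without erasure to the mean loss. -/
def keptFactor (p α : ℝ) : ℝ := (p ^ (1 + 2 * α) + (1 - p) ^ (1 + 2 * α)) ^ (1 / 4 : ℝ)

theorem erasedFactor_pos (α : ℝ) : 0 < erasedFactor α := by
  unfold erasedFactor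
  positivity

/-- By convexity of `x ^ (1 + 2α)`, the moment of a bit is least when the bit is uniform. -/
theorem erasedFactor_le_keptFactor {p : ℝ} (h0 : 0 ≤ p) (h1 : p ≤ 1) {α : ℝ} (hα : 0 ≤ α) :
    erasedFactor α ≤ keptFactor p α := by
  refine Real.rpow_le_rpow (by positivity) ?_ (by norm_num)
  have h := (convexOn_rpow (show 1 ≤ 1 + 2 * α by linarith)).2 (Set.mem_Ici.2 h0)
    (Set.mem_Ici.2 (sub_nonneg.2 h1)) (show (0 : ℝ) ≤ 1 / 2 by norm_num)
    (show (0 : ℝ) ≤ 1 / 2 by norm_num) (by norm_num)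
  simp only [smul_eq_mul] at h
  rw [show 1 / 2 * p + 1 / 2 * (1 - p) = (2 : ℝ)⁻¹ by ring, Real.inv_rpow (by norm_num),
    ← Real.rpow_neg (by norm_num)] at h
  have h2 : (2 : ℝ) ^ (-(2 * α)) = 2 * 2 ^ (-(1 + 2 * α)) := by
    rw [show -(2 * α) = 1 + -(1 + 2 * α) by ring, Real.rpow_add (by norm_num), Real.rpow_one]
  rw [h2]
  linarith

theorem sum_noise_rpow (p : unitInterval) (e : Bool) (α : ℝ) :
    ∑ b, (noise p e b).toReal ^ (1 + 2 * α) =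
      if e = true then (2 : ℝ) ^ (-(2 * α))
      else (p : ℝ) ^ (1 + 2 * α) + (1 - p) ^ (1 + 2 * α) := by
  have h0 := p.2.1
  have h1 : 0 ≤ 1 - (p : ℝ) := sub_nonneg.2 p.2.2
  rw [univ_zmod_two, Finset.sum_pair (by decide)]
  simp only [noise_apply]
  cases e
  · simp only [if_true, one_ne_zero, if_false, Bool.false_eq_true]
    rw [ENNReal.toReal_ofReal h0, ENNReal.toReal_ofReal h1, add_comm]
  · simp only [if_true]
    rw [ENNReal.toReal_ofReal (by norm_num), one_div, Real.inv_rpow (by norm_num),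
      ← Real.rpow_neg (by norm_num), ← two_mul, show -(2 * α) = 1 + -(1 + 2 * α) by ring,
      Real.rpow_add (by norm_num), Real.rpow_one]

theorem prod_ite_weight {n : ℕ} (e : Fin n → Bool) (a b : ℝ) :
    ∏ j, (if e j = true then a else b) = a ^ weight e * b ^ (n - weight e) := by
  rw [Finset.prod_ite, Finset.prod_const, Finset.prod_const, weight, Fintype.card_subtype,
    Finset.filter_not, Finset.card_sdiff_of_subset (Finset.filter_subset _ _), Finset.card_univ,
    Fintype.card_fin]

/-- The moment is multiplicative over positions. The factors are fourth roots: one square root comes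
from Cauchy–Schwarz, and the squares left here are later spread over all `2 n₀` positions. -/
theorem sqrt_sum_noiseLaw_rpow (p : unitInterval) {n : ℕ} (e : Fin n → Bool) (α : ℝ) :
    √(∑ v, (noiseLaw p e v).toReal ^ (1 + 2 * α)) =
      (erasedFactor α ^ 2) ^ weight e * (keptFactor p α ^ 2) ^ (n - weight e) := by
  have h0 := p.2.1
  have h1 : 0 ≤ 1 - (p : ℝ) := sub_nonneg.2 p.2.2
  have hG : 0 ≤ (p : ℝ) ^ (1 + 2 * α) + (1 - p) ^ (1 + 2 * α) := by positivity
  have hA : (0 : ℝ) ≤ 2 ^ (-(2 * α)) := by positivity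
  have hs : ∀ x : ℝ, 0 ≤ x → (x ^ (1 / 4 : ℝ)) ^ 2 = √x := fun x hx => by
    rw [Real.sqrt_eq_rpow, ← Real.rpow_natCast, ← Real.rpow_mul hx]
    norm_num
  have hsp : ∀ x : ℝ, 0 ≤ x → ∀ k : ℕ, √(x ^ k) = √x ^ k := fun x hx k => by
    rw [← Real.sqrt_sq (pow_nonneg (Real.sqrt_nonneg x) k), ← pow_mul, mul_comm, pow_mul,
      Real.sq_sqrt hx]
  have hp : ∀ v, (noiseLaw p e v).toReal ^ (1 + 2 * α) =
      ∏ j, (noise p (e j) (v j)).toReal ^ (1 + 2 * α) := fun v => by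
    rw [noiseLaw, independent_apply, ENNReal.toReal_prod,
      Real.finsetProd_rpow _ _ fun j _ => ENNReal.toReal_nonneg]
  have hprod := Finset.prod_univ_sum (fun _ : Fin n => (Finset.univ : Finset (ZMod 2)))
    fun j b => (noise p (e j) b).toReal ^ (1 + 2 * α)
  rw [Fintype.piFinset_univ] at hprod
  simp only [hp]
  rw [← hprod]
  simp only [sum_noise_rpow]
  rw [prod_ite_weight, Real.sqrt_mul (pow_nonneg hA _), erasedFactor, keptFactor, hs _ hA,
    hs _ hG, hsp _ hA, hsp _ hG]

theorem card_word (m : ℕ) : Fintype.card (Word m) = 2 ^ m := by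
  rw [Fintype.card_pi]
  simp [ZMod.card]

theorem weight_comp_perm {n : ℕ} (e : Fin n → Bool) (σ : Equiv.Perm (Fin n)) :
    weight (fun j => e (σ j)) = weight e :=
  Fintype.card_congr (σ.subtypeEquiv fun _ => Iff.rfl)

/-- Privacy amplification applies to each rearrangement separately, and its bound sees only the
weight of the pattern. -/
theorem sum_meanDeficiency_le (p : unitInterval) {s m n : ℕ}
    (H₀ : Matrix (Fin s) (Fin n) (ZMod 2)) {e : ℕ} (he : e ≤ n) {α : ℝ} (hα : 0 < α)
    (hα1 : α ≤ 1 / 2) :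
    ∑ H₁ : Matrix (Fin m) (Fin n) (ZMod 2), meanDeficiency p H₀ H₁ e ≤
      Fintype.card (Matrix (Fin m) (Fin n) (ZMod 2)) *
        (((2 : ℝ) ^ m) ^ α * ((2 : ℝ) ^ s) ^ α *
          ((erasedFactor α ^ 2) ^ e * (keptFactor p α ^ 2) ^ (n - e)) / (α * Real.log 2)) := by
  simp only [meanDeficiency]
  rw [Finset.sum_comm]
  simp only [← Finset.mul_sum]
  conv_rhs => rw [← one_mul (_ * _),
    ← sum_toReal_eq_one (PMF.uniformOfFintype (Equiv.Perm (Fin n))), Finset.sum_mul]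
  refine Finset.sum_le_sum fun σ _ => mul_le_mul_of_nonneg_left ?_ ENNReal.toReal_nonneg
  have h := (isUniversal_matrixHom m n).sum_deficiency_le (matrixHom H₀)
    (P := fun v => (noiseLaw p (fun j => initialPattern n e (σ j)) v).toReal)
    (fun _ => ENNReal.toReal_nonneg) (sum_toReal_eq_one _) hα hα1
  rw [sqrt_sum_noiseLaw_rpow, weight_comp_perm, weight_initialPattern he, card_word,
    card_word] at h
  exact_mod_cast h

/-- Passes from the `e` erasures of the noisier half to the total `t`, whose law does not depend on
Bob: extra erasures only lower the product. -/
theorem pow_mul_pow_le {a b : ℝ} (ha : 0 < a) (hab : a ≤ b) {n e t : ℕ} (he : e ≤ n)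
    (ht : t ≤ 2 * e) : (a ^ 2) ^ e * (b ^ 2) ^ (n - e) ≤ a ^ t * b ^ (2 * n - t) := by
  have hb := ha.trans_le hab
  obtain ⟨d, hd⟩ := Nat.exists_eq_add_of_le ht
  rw [← pow_mul, ← pow_mul, hd, pow_add, mul_assoc,
    show 2 * n - t = d + 2 * (n - e) by omega, pow_add]
  gcongr

theorem toReal_pairLaw (φ : unitInterval) (z : ZMod 2 × ZMod 2) :
    (pairLaw φ z).toReal =
      if erased z then φ * (1 - φ : ℝ) else (1 - 2 * φ * (1 - φ)) / 2 := by
  rw [pairLaw_apply, ENNReal.toReal_ofReal]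
  have := erasureProb_le φ
  split_ifs
  · exact mul_nonneg φ.2.1 (sub_nonneg.2 φ.2.2)
  · linarith

/-- The generating function of a binomial number of erasures among `2 n₀` independent pairs. -/
theorem sum_receivedLaw_mul (φ : unitInterval) (n₀ : ℕ) (a b : ℝ) :
    ∑ z : Received n₀, (receivedLaw φ n₀ z).toReal *
        (a ^ totalErasures z * b ^ (2 * n₀ - totalErasures z)) =
      (2 * φ * (1 - φ) * a + (1 - 2 * φ * (1 - φ)) * b) ^ (2 * n₀) := by
  have h : ∀ z : Received n₀, (receivedLaw φ n₀ z).toReal *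
        (a ^ totalErasures z * b ^ (2 * n₀ - totalErasures z)) =
      ∏ i, (pairLaw φ (z i)).toReal * (if erased (z i) = true then a else b) := by
    intro z
    rw [Finset.prod_mul_distrib, prod_ite_weight fun i => erased (z i), receivedLaw,
      independent_apply, ENNReal.toReal_prod, weight, Fintype.card_subtype, totalErasures]
  simp only [h]
  have hprod := Finset.prod_univ_sum
    (fun _ : Fin (2 * n₀) => (Finset.univ : Finset (ZMod 2 × ZMod 2)))
    fun _ z => (pairLaw φ z).toReal * (if erased z = true then a else b)
  rw [Fintype.piFinset_univ] at hprod
  rw [← hprod, Finset.prod_const, Finset.card_univ, Fintype.card_fin]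
  congr 1
  rw [Fintype.sum_prod_type, univ_zmod_two]
  simp only [Finset.sum_pair (show (0 : ZMod 2) ≠ 1 by decide), toReal_pairLaw]
  simp [erased]
  ring

/-- The mean of the loss over the hash matrix. -/
theorem sum_loss_le (φ : unitInterval) {s m n₀ : ℕ} (H₀ : Matrix (Fin s) (Fin n₀) (ZMod 2))
    {α : ℝ} (hα : 0 < α) (hα1 : α ≤ 1 / 2) :
    ∑ H₁ : Matrix (Fin m) (Fin n₀) (ZMod 2), loss φ H₀ H₁ ≤
      Fintype.card (Matrix (Fin m) (Fin n₀) (ZMod 2)) *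
        (m * (2 ^ m / Nat.card (matrixHom H₀).ker) +
          (n₀ + 1) * (((2 : ℝ) ^ m) ^ α * ((2 : ℝ) ^ s) ^ α / (α * Real.log 2) *
            (2 * φ * (1 - φ) * erasedFactor α +
              (1 - 2 * φ * (1 - φ)) * keptFactor (residualCrossover φ) α) ^ (2 * n₀))) := by
  classical
  have hl : 0 < Real.log 2 := Real.log_pos (by norm_num)
  set N : ℝ := (Fintype.card (Matrix (Fin m) (Fin n₀) (ZMod 2)) : ℝ) with hN
  set C : ℝ := ((2 : ℝ) ^ m) ^ α * ((2 : ℝ) ^ s) ^ α / (α * Real.log 2) with hC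
  have hC0 : 0 ≤ C := by positivity
  set a := erasedFactor α with ha
  set b := keptFactor (residualCrossover φ) α with hb
  have ha0 : 0 < a := erasedFactor_pos α
  have hab : a ≤ b :=
    erasedFactor_le_keptFactor (residualCrossover φ).2.1 (residualCrossover φ).2.2 hα.le
  simp only [loss]
  rw [Finset.sum_add_distrib, mul_add]
  refine add_le_add ?_ ?_
  · have hker : (0 : ℝ) < Nat.card (matrixHom H₀).ker := by exact_mod_cast Nat.card_pos
    have h := (isUniversal_matrixHom m n₀).ncard_not_onto_mul_le (matrixHom H₀)
    rw [card_word] at h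
    have h2 : ({H₁ | ¬ ∀ x, ∃ c, matrixHom H₀ c = 0 ∧ matrixHom H₁ c = x} :
        Set (Matrix (Fin m) (Fin n₀) (ZMod 2))).ncard =
        (Finset.univ.filter fun H₁ : Matrix (Fin m) (Fin n₀) (ZMod 2) => ¬ IsOnto H₀ H₁).card := by
      rw [← Set.ncard_coe_finset]
      congr 1
      ext H₁
      simp [IsOnto]
    rw [h2] at h
    have h3 : ((Finset.univ.filter fun H₁ : Matrix (Fin m) (Fin n₀) (ZMod 2) =>
        ¬ IsOnto H₀ H₁).card : ℝ) ≤ N * (2 ^ m / Nat.card (matrixHom H₀).ker) := by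
      rw [← mul_div_assoc, le_div_iff₀ hker, hN]
      exact_mod_cast h
    have h4 : ∑ H₁ : Matrix (Fin m) (Fin n₀) (ZMod 2), (if IsOnto H₀ H₁ then 0 else (m : ℝ)) =
        (Finset.univ.filter fun H₁ : Matrix (Fin m) (Fin n₀) (ZMod 2) =>
          ¬ IsOnto H₀ H₁).card * m := by
      rw [← nsmul_eq_mul, ← Finset.sum_const, Finset.sum_filter]
      exact Finset.sum_congr rfl fun H₁ _ => by split_ifs <;> rfl
    rw [h4]
    calc _ ≤ N * (2 ^ m / Nat.card (matrixHom H₀).ker) * m :=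
          mul_le_mul_of_nonneg_right h3 (Nat.cast_nonneg m)
      _ = _ := by ring
  · rw [Finset.sum_comm, ← sum_receivedLaw_mul φ n₀ a b]
    simp only [Finset.mul_sum]
    refine Finset.sum_le_sum fun z _ => ?_
    set t := totalErasures z with ht
    calc ∑ H₁ : Matrix (Fin m) (Fin n₀) (ZMod 2), ∑ e ∈ Finset.range (n₀ + 1) with t ≤ 2 * e,
          (receivedLaw φ n₀ z).toReal * meanDeficiency (residualCrossover φ) H₀ H₁ e
        = (receivedLaw φ n₀ z).toReal * ∑ e ∈ Finset.range (n₀ + 1) with t ≤ 2 * e,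
            ∑ H₁ : Matrix (Fin m) (Fin n₀) (ZMod 2),
              meanDeficiency (residualCrossover φ) H₀ H₁ e := by
          rw [Finset.sum_comm, Finset.mul_sum]
          simp only [Finset.mul_sum]
      _ ≤ (receivedLaw φ n₀ z).toReal * ∑ e ∈ Finset.range (n₀ + 1) with t ≤ 2 * e,
            N * (C * (a ^ t * b ^ (2 * n₀ - t))) := by
          refine mul_le_mul_of_nonneg_left (Finset.sum_le_sum fun e he => ?_)
            ENNReal.toReal_nonneg
          rw [Finset.mem_filter, Finset.mem_range, Nat.lt_succ_iff] at he
          refine (sum_meanDeficiency_le _ H₀ he.1 hα hα1).trans ?_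
          refine mul_le_mul_of_nonneg_left ?_ (Nat.cast_nonneg _)
          rw [mul_div_right_comm]
          exact mul_le_mul_of_nonneg_left (pow_mul_pow_le ha0 hab he.1 he.2) hC0
      _ ≤ (receivedLaw φ n₀ z).toReal * ((n₀ + 1) * (N * (C * (a ^ t * b ^ (2 * n₀ - t))))) := by
          refine mul_le_mul_of_nonneg_left ?_ ENNReal.toReal_nonneg
          have hb0 := ha0.trans_le hab
          rw [Finset.sum_const, nsmul_eq_mul]
          refine mul_le_mul_of_nonneg_right ?_ (by positivity)
          have := Finset.card_filter_le (Finset.range (n₀ + 1)) fun e => t ≤ 2 * e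
          rw [Finset.card_range] at this
          exact_mod_cast this
      _ = _ := by ring

/-! ### The error exponent -/

theorem hasDerivAt_erasedFactor : HasDerivAt erasedFactor (-(Real.log 2 / 2)) 0 := by
  have h1 : HasDerivAt (fun α : ℝ => -(2 * α)) (-(2 * 1)) 0 :=
    ((hasDerivAt_id (0 : ℝ)).const_mul 2).neg
  have h2 := (h1.const_rpow (a := 2) (by norm_num)).rpow_const (p := 1 / 4) (Or.inl (by simp))
  refine h2.congr_deriv ?_
  norm_num
  ring

/-- The derivative of `∑ P ^ (1 + 2α)` at `α = 0` is minus twice the entropy of `P` in nats; the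
fourth root divides this by four. An erased position is the uniform case, with entropy `log 2`. -/
theorem hasDerivAt_keptFactor {p : ℝ} (h0 : 0 < p) (h1 : p < 1) :
    HasDerivAt (keptFactor p) (-(Real.binEntropy p / 2)) 0 := by
  have h2 : HasDerivAt (fun α : ℝ => 1 + 2 * α) (2 * 1) 0 :=
    ((hasDerivAt_id (0 : ℝ)).const_mul 2).const_add 1
  have h3 := ((h2.const_rpow h0).add (h2.const_rpow (sub_pos.2 h1))).rpow_const (p := 1 / 4)
    (Or.inl (by simp))
  refine h3.congr_deriv ?_
  simp only [Real.binEntropy, Real.log_inv, Pi.add_apply]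
  norm_num
  ring

theorem erasedFactor_zero : erasedFactor 0 = 1 := by
  simp [erasedFactor]

theorem keptFactor_zero (p : ℝ) : keptFactor p 0 = 1 := by
  simp [keptFactor]

theorem exists_lt_of_hasDerivAt_neg {F : ℝ → ℝ} {F' : ℝ} (h : HasDerivAt F F' 0) (hneg : F' < 0) :
    ∃ α, 0 < α ∧ α ≤ 1 / 2 ∧ F α < F 0 := by
  have h1 := (hasDerivAt_iff_tendsto_slope.1 h).eventually (eventually_lt_nhds hneg)
  have h2 : ∀ᶠ α in nhdsWithin (0 : ℝ) (Set.Ioi 0), slope F 0 α < 0 :=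
    h1.filter_mono (nhdsWithin_mono _ fun x hx => ne_of_gt hx)
  have h3 : ∀ᶠ α in nhdsWithin (0 : ℝ) (Set.Ioi 0), α ∈ Set.Ioc (0 : ℝ) (1 / 2) :=
    Ioc_mem_nhdsGT (by norm_num)
  obtain ⟨α, hs, hα0, hα1⟩ := (h2.and h3).exists
  refine ⟨α, hα0, hα1, ?_⟩
  rw [slope_def_field, sub_zero, div_lt_iff₀ hα0, zero_mul] at hs
  linarith

/-- If the rate is below the capacity of Bob's ignorance, the error exponent is positive. -/
theorem exists_exponent {p ε δ : ℝ} (h0 : 0 < p) (h1 : p < 1) (hδ : 0 < δ) :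
    ∃ α, 0 < α ∧ α ≤ 1 / 2 ∧
      (2 : ℝ) ^ ((1 - (1 - ε) * (1 - binaryEntropy p) - δ) * α) *
        (ε * erasedFactor α + (1 - ε) * keptFactor p α) ^ 2 < 1 := by
  have hl : 0 < Real.log 2 := Real.log_pos (by norm_num)
  set c := 1 - (1 - ε) * (1 - binaryEntropy p) - δ with hc
  have d1 : HasDerivAt (fun α : ℝ => c * α) (c * 1) 0 := (hasDerivAt_id (0 : ℝ)).const_mul c
  have d2 := (d1.const_rpow (a := 2) (by norm_num)).mul
    (((hasDerivAt_erasedFactor.const_mul ε).add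
      ((hasDerivAt_keptFactor h0 h1).const_mul (1 - ε))).pow 2)
  have hb : Real.binEntropy p = binaryEntropy p * Real.log 2 := by
    rw [binaryEntropy, div_mul_cancel₀ _ hl.ne']
  -- The entropy terms cancel against `c`, and the derivative at `0` is `-δ log 2`.
  obtain ⟨α, hα0, hα1, h⟩ := exists_lt_of_hasDerivAt_neg d2 (by
    simp only [Pi.add_apply, Pi.pow_apply, erasedFactor_zero, keptFactor_zero, hb, hc]
    norm_num
    nlinarith [mul_pos hδ hl])
  refine ⟨α, hα0, hα1, ?_⟩
  simpa [erasedFactor_zero, keptFactor_zero] using h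

/-- Of the two factors of `θ ^ n = √θ ^ n * √θ ^ n`, one absorbs `n + 1` and the other decays in `m
≤ n`. -/
theorem exists_bound_succ_mul_pow {θ : ℝ} (h0 : 0 < θ) (h1 : θ < 1) :
    ∃ K c : ℝ, 0 < K ∧ 0 < c ∧ ∀ m n : ℕ, m ≤ n → (n + 1) * θ ^ n ≤ K * Real.exp (-c * m) := by
  have hs0 : 0 < √θ := Real.sqrt_pos.2 h0
  have hs1 : √θ < 1 := by
    rw [Real.sqrt_lt' one_pos]
    simpa using h1
  have htend := (tendsto_self_mul_const_pow_of_lt_one hs0.le hs1).add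
    (tendsto_pow_atTop_nhds_zero_of_lt_one hs0.le hs1)
  obtain ⟨K, hK⟩ := htend.bddAbove_range
  refine ⟨max K 1, -Real.log √θ, by positivity, neg_pos.2 (Real.log_neg hs0 hs1), ?_⟩
  intro m n hmn
  have h2 : (n + 1) * √θ ^ n ≤ max K 1 := by
    refine le_trans (le_of_eq ?_) ((hK ⟨n, rfl⟩).trans (le_max_left K 1))
    ring
  have h3 : Real.exp (- -Real.log √θ * m) = √θ ^ m := by
    rw [neg_neg, mul_comm, Real.exp_nat_mul, Real.exp_log hs0]
  rw [h3]
  calc (n + 1) * θ ^ n = (n + 1) * √θ ^ n * √θ ^ n := by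
        rw [mul_assoc, ← mul_pow, Real.mul_self_sqrt h0.le]
    _ ≤ max K 1 * √θ ^ m :=
        mul_le_mul h2 (pow_le_pow_of_le_one hs0.le hs1.le hmn) (by positivity) (by positivity)

theorem residualCrossover_pos {φ : unitInterval} (h : 0 < (φ : ℝ)) :
    0 < (residualCrossover φ : ℝ) :=
  div_pos (by positivity) (by linarith [erasureProb_le φ])

theorem residualCrossover_lt_one {φ : unitInterval} (h : (φ : ℝ) < 1 / 2) :
    (residualCrossover φ : ℝ) < 1 := by
  refine (div_lt_one (by linarith [erasureProb_le φ])).2 ?_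
  nlinarith [pow_pos (show 0 < 1 - (φ : ℝ) by linarith) 2]

theorem binaryEntropy_le_one (p : ℝ) : binaryEntropy p ≤ 1 :=
  div_le_one_of_le₀ Real.binEntropy_le_log_two (Real.log_nonneg (by norm_num))

/-- Below the rate of the theorem, the mean loss is exponentially small in the length of the
secrets. -/
theorem exists_sum_loss_le (φ : unitInterval) (hφ : (φ : ℝ) < 1 / 2) {δ : ℝ} (hδ : 0 < δ) :
    ∃ A c : ℝ, 0 < c ∧ ∀ n₀ k m : ℕ, 0 < n₀ → k ≤ n₀ →
      ∀ H₀ : Matrix (Fin (n₀ - k)) (Fin n₀) (ZMod 2), Nat.card (matrixHom H₀).ker = 2 ^ k →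
      (m : ℝ) ≤ k - n₀ * ((1 - 2 * φ * (1 - φ)) *
        (1 - binaryEntropy (residualCrossover φ)) + δ) →
      ∑ H₁ : Matrix (Fin m) (Fin n₀) (ZMod 2), loss φ H₀ H₁ ≤
        Fintype.card (Matrix (Fin m) (Fin n₀) (ZMod 2)) * (A * Real.exp (-c * m)) := by
  have hl : 0 < Real.log 2 := Real.log_pos (by norm_num)
  -- For `φ = 0` the residual crossover is `0`, where `keptFactor` need not have the derivative used
  -- below; but then the rate condition would force `m < 0`.
  rcases φ.2.1.eq_or_lt with hz | hpos
  · refine ⟨0, 1, one_pos, fun n₀ k m hn hk H₀ _ hm => ?_⟩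
    exfalso
    have hp : (residualCrossover φ : ℝ) = 0 := by simp [residualCrossover, ← hz]
    rw [hp, ← hz] at hm
    simp only [binaryEntropy, Real.binEntropy_zero, zero_div] at hm
    have hk' : (k : ℝ) ≤ n₀ := by exact_mod_cast hk
    have hn' : (0 : ℝ) < n₀ := by exact_mod_cast hn
    have hm' : (0 : ℝ) ≤ m := Nat.cast_nonneg m
    nlinarith [mul_pos hn' hδ]
  set p : ℝ := (residualCrossover φ).1 with hp
  set ε : ℝ := 2 * φ * (1 - φ) with hε
  have hε1 : 0 ≤ 1 - ε := by linarith [erasureProb_le φ]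
  have hε0 : 0 ≤ ε := mul_nonneg (by linarith) (by linarith)
  obtain ⟨α, hα0, hα1, hF⟩ := exists_exponent (ε := ε) (residualCrossover_pos hpos)
    (residualCrossover_lt_one hφ) hδ
  rw [← hp] at hF
  set D := ε * erasedFactor α + (1 - ε) * keptFactor p α with hD
  have hD0 : 0 ≤ D := by
    have h1 := erasedFactor_pos α
    have h2 := h1.trans_le (erasedFactor_le_keptFactor (residualCrossover φ).2.1
      (residualCrossover φ).2.2 hα0.le)
    positivity
  set R := 1 - (1 - ε) * (1 - binaryEntropy p) - δ with hR
  -- The first rate covers secrets without encodings, since `m - k ≤ -δ n₀`; the second covers the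
  -- deficiency, since `m + (n₀ - k) ≤ R n₀`.
  set θ := max ((2 : ℝ) ^ (-δ)) ((2 : ℝ) ^ (R * α) * D ^ 2) with hθ
  have hθ0 : 0 < θ := lt_max_of_lt_left (by positivity)
  have hθ1 : θ < 1 := max_lt (Real.rpow_lt_one_of_one_lt_of_neg (by norm_num) (by linarith)) hF
  obtain ⟨K, c, hK, hc, hbound⟩ := exists_bound_succ_mul_pow hθ0 hθ1
  refine ⟨(1 + 1 / (α * Real.log 2)) * K, c, hc, fun n₀ k m hn hk H₀ hker hm => ?_⟩
  have hk' : (k : ℝ) ≤ n₀ := by exact_mod_cast hk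
  have hn' : (0 : ℝ) < n₀ := by exact_mod_cast hn
  have hcap : 0 ≤ (1 - ε) * (1 - binaryEntropy p) :=
    mul_nonneg hε1 (sub_nonneg.2 (binaryEntropy_le_one p))
  have hmk : (m : ℝ) - k ≤ n₀ * -δ := by nlinarith [mul_nonneg hn'.le hcap]
  have hmn : m ≤ n₀ := by
    have : (m : ℝ) ≤ n₀ := by nlinarith [mul_pos hn' hδ]
    exact_mod_cast this
  refine (sum_loss_le φ H₀ hα0 hα1).trans (mul_le_mul_of_nonneg_left ?_ (Nat.cast_nonneg _))
  rw [← hp, ← hε, ← hD, hker]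
  have t1 : (2 : ℝ) ^ m / ((2 ^ k : ℕ) : ℝ) ≤ θ ^ n₀ := by
    push_cast
    rw [← Real.rpow_natCast, ← Real.rpow_natCast, ← Real.rpow_sub (by norm_num)]
    refine (Real.rpow_le_rpow_of_exponent_le (by norm_num) hmk).trans ?_
    rw [mul_comm, Real.rpow_mul (by norm_num), Real.rpow_natCast]
    exact pow_le_pow_left₀ (by positivity) (le_max_left _ _) _
  have t2 : ((2 : ℝ) ^ m) ^ α * ((2 : ℝ) ^ (n₀ - k)) ^ α * D ^ (2 * n₀) ≤ θ ^ n₀ := by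
    have e1 : ((2 : ℝ) ^ m) ^ α * ((2 : ℝ) ^ (n₀ - k)) ^ α ≤ ((2 : ℝ) ^ (R * α)) ^ n₀ := by
      rw [← Real.rpow_natCast, ← Real.rpow_natCast, ← Real.rpow_natCast,
        ← Real.rpow_mul (by norm_num), ← Real.rpow_mul (by norm_num),
        ← Real.rpow_mul (by norm_num), ← Real.rpow_add (by norm_num), Nat.cast_sub hk]
      refine Real.rpow_le_rpow_of_exponent_le (by norm_num) ?_
      rw [← add_mul, mul_right_comm]
      refine mul_le_mul_of_nonneg_right ?_ hα0.le
      rw [hR]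
      linarith
    calc _ ≤ ((2 : ℝ) ^ (R * α)) ^ n₀ * D ^ (2 * n₀) :=
          mul_le_mul_of_nonneg_right e1 (by positivity)
      _ = ((2 : ℝ) ^ (R * α) * D ^ 2) ^ n₀ := by rw [mul_pow, pow_mul]
      _ ≤ θ ^ n₀ := pow_le_pow_left₀ (by positivity) (le_max_right _ _) _
  calc m * ((2 : ℝ) ^ m / ((2 ^ k : ℕ) : ℝ)) + (n₀ + 1) *
        (((2 : ℝ) ^ m) ^ α * ((2 : ℝ) ^ (n₀ - k)) ^ α / (α * Real.log 2) * D ^ (2 * n₀))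
      ≤ (n₀ + 1) * θ ^ n₀ + (n₀ + 1) * (1 / (α * Real.log 2) * θ ^ n₀) := by
        have hm' : (m : ℝ) ≤ n₀ + 1 := by exact_mod_cast hmn.trans (Nat.le_succ _)
        refine add_le_add (mul_le_mul hm' t1 (by positivity) (by positivity)) ?_
        refine mul_le_mul_of_nonneg_left ?_ (by positivity)
        rw [div_mul_eq_mul_div, one_div_mul_eq_div]
        exact div_le_div_of_nonneg_right t2 (by positivity)
    _ = (1 + 1 / (α * Real.log 2)) * ((n₀ + 1) * θ ^ n₀) := by ring
    _ ≤ (1 + 1 / (α * Real.log 2)) * (K * Real.exp (-c * m)) :=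
        mul_le_mul_of_nonneg_left (hbound m n₀ hmn) (by positivity)
    _ = _ := by ring

/-! ### Size of the code, Markov's inequality and conclusion -/

theorem card_ker_matrixHom {s n : ℕ} (H₀ : Matrix (Fin s) (Fin n) (ZMod 2)) :
    Nat.card (matrixHom H₀).ker = 2 ^ Module.finrank (ZMod 2) (LinearMap.ker H₀.mulVecLin) := by
  have h := Module.natCard_eq_pow_finrank (K := ZMod 2) (V := LinearMap.ker H₀.mulVecLin)
  rw [Nat.card_zmod] at h
  rw [← h]
  rfl

theorem toReal_uniform_apply {α : Type} [Fintype α] [Nonempty α] (a : α) :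
    (PMF.uniformOfFintype α a).toReal = (Fintype.card α : ℝ)⁻¹ := by
  simp

/-- Markov's inequality for a uniformly random element. -/
theorem uniform_measure_le {α : Type} [Fintype α] [Nonempty α] {X : α → ℝ} (hX : ∀ a, 0 ≤ X a)
    {t b : ℝ} (ht : 0 < t) (hb : ∑ a, X a ≤ Fintype.card α * b) {S : Set α}
    (hS : ∀ a ∈ S, t ≤ X a) :
    ((PMF.uniformOfFintype α).toOuterMeasure S).toReal ≤ b / t := by
  classical
  have hN : (0 : ℝ) < Fintype.card α := by exact_mod_cast Fintype.card_pos
  rw [PMF.toOuterMeasure_apply_fintype, ENNReal.toReal_sum, le_div_iff₀ ht, Finset.sum_mul]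
  · calc ∑ a, (S.indicator (PMF.uniformOfFintype α) a).toReal * t
        ≤ ∑ a, (Fintype.card α : ℝ)⁻¹ * X a := by
          refine Finset.sum_le_sum fun a _ => ?_
          by_cases ha : a ∈ S
          · rw [Set.indicator_of_mem ha, toReal_uniform_apply]
            exact mul_le_mul_of_nonneg_left (hS a ha) (by positivity)
          · rw [Set.indicator_of_notMem ha, ENNReal.toReal_zero, zero_mul]
            exact mul_nonneg (by positivity) (hX a)
      _ ≤ b := by
          rw [← Finset.mul_sum, inv_mul_le_iff₀ hN]
          exact hb
  · intro a _
    exact ne_top_of_le_ne_top ((PMF.uniformOfFintype α).apply_ne_top a)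
      (Set.indicator_le_self _ _ a)

end ObliviousTransfer

end

theorem mainTheorem2 (φ : unitInterval) (hφ : (φ : ℝ) < 1 / 2) :
    ∃ f₀ : ℝ → ℕ → ℝ, ∀ ε' : ℝ, 0 < ε' →
      (∃ A c : ℝ, 0 < c ∧ ∀ m : ℕ, 0 ≤ f₀ ε' m ∧ f₀ ε' m ≤ A * Real.exp (-c * m)) ∧
      ∀ (n₀ k m : ℕ), 0 < n₀ →
      ∀ (C₀ : Submodule (ZMod 2) (ObliviousTransfer.Word n₀)), Module.finrank (ZMod 2) C₀ = k →
      ∀ (H₀ : Matrix (Fin (n₀ - k)) (Fin n₀) (ZMod 2)), LinearMap.ker H₀.mulVecLin = C₀ →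
      ∀ (ε R₀ : ℝ), ε = 2 * φ * (1 - φ) → R₀ = k / n₀ →
      (m : ℝ) ≤ n₀ * (R₀ - (1 - ε) * (1 - ObliviousTransfer.binaryEntropy (φ ^ 2 / (1 - ε)))
        - ε') →
      ∀ bob : ObliviousTransfer.Strategy m n₀,
        (m : ℝ) - f₀ ε' m ≤
            ObliviousTransfer.condEntropy (ObliviousTransfer.protocol φ H₀ bob)
              ObliviousTransfer.Run.noisierSecret ObliviousTransfer.Run.view ∧
          ((PMF.uniformOfFintype (Matrix (Fin m) (Fin n₀) (ZMod 2))).toOuterMeasure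
            {H₁ | ObliviousTransfer.condEntropy (ObliviousTransfer.protocolGiven φ H₀ bob H₁)
              ObliviousTransfer.Run.noisierSecret ObliviousTransfer.Run.view
                < (m : ℝ) - f₀ ε' m}).toReal ≤ f₀ ε' m := by
  have hex := fun ε' : {δ : ℝ // 0 < δ} => ObliviousTransfer.exists_sum_loss_le φ hφ ε'.2
  choose A c hc hA using hex
  set B : {δ : ℝ // 0 < δ} → ℝ := fun ε' => max (A ε') 1 with hB
  -- Half the decay rate of the mean loss, with `B ≥ 1`, so that the mean loss is at most both `f₀`
  -- and `f₀ ^ 2`: the second bound makes Markov's inequality at threshold `f₀` give probability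
  -- `f₀`. The value at `ε' ≤ 0` is immaterial.
  refine ⟨fun ε' m => if h : 0 < ε' then B ⟨ε', h⟩ * Real.exp (-(c ⟨ε', h⟩ / 2) * m) else 0,
    fun ε' hε' => ?_⟩
  simp only [dif_pos hε']
  have hB1 : 1 ≤ B ⟨ε', hε'⟩ := le_max_right _ _
  refine ⟨⟨B ⟨ε', hε'⟩, c ⟨ε', hε'⟩ / 2, half_pos (hc _), fun m => ⟨by positivity, le_rfl⟩⟩, ?_⟩
  intro n₀ k m hn C₀ hk H₀ hker ε R₀ hε hR hm bob
  have hkn : k ≤ n₀ := by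
    rw [← hk]
    simpa using C₀.finrank_le
  have hcard : Nat.card (ObliviousTransfer.matrixHom H₀).ker = 2 ^ k := by
    rw [ObliviousTransfer.card_ker_matrixHom, hker, hk]
  have hn' : (n₀ : ℝ) ≠ 0 := by exact_mod_cast hn.ne'
  have hloss := hA ⟨ε', hε'⟩ n₀ k m hn hkn H₀ hcard (by
    refine hm.trans (le_of_eq ?_)
    rw [hR, hε, mul_sub, mul_sub, mul_div_cancel₀ _ hn']
    simp only [ObliviousTransfer.residualCrossover]
    ring)
  set a := A ⟨ε', hε'⟩ with ha
  set b := B ⟨ε', hε'⟩ with hb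
  set d := c ⟨ε', hε'⟩ with hd
  have hd0 : 0 < d := hc _
  set f := b * Real.exp (-(d / 2) * m) with hf
  have hf0 : 0 < f := by positivity
  have hle : a * Real.exp (-d * m) ≤ f * f := by
    have h1 : f * f = b * (b * Real.exp (-d * m)) := by
      rw [hf, mul_mul_mul_comm, ← Real.exp_add, mul_assoc]
      congr 4
      ring
    rw [h1]
    calc a * Real.exp (-d * m) ≤ b * Real.exp (-d * m) :=
          mul_le_mul_of_nonneg_right (le_max_left _ _) (Real.exp_pos _).le
      _ ≤ b * (b * Real.exp (-d * m)) := le_mul_of_one_le_left (by positivity) hB1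
  have hle' : a * Real.exp (-d * m) ≤ f := by
    calc a * Real.exp (-d * m) ≤ b * Real.exp (-d * m) :=
          mul_le_mul_of_nonneg_right (le_max_left _ _) (Real.exp_pos _).le
      _ ≤ f := by
          refine mul_le_mul_of_nonneg_left (Real.exp_le_exp.2 ?_) (by positivity)
          nlinarith [mul_nonneg hd0.le (Nat.cast_nonneg (α := ℝ) m)]
  have hN : (0 : ℝ) < Fintype.card (Matrix (Fin m) (Fin n₀) (ZMod 2)) := by
    exact_mod_cast Fintype.card_pos
  constructor
  · rw [ObliviousTransfer.condEntropy_protocol]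
    simp only [ObliviousTransfer.toReal_uniform_apply]
    rw [← Finset.mul_sum, ← div_eq_inv_mul, le_div_iff₀ hN]
    have h1 := Finset.sum_le_sum fun H₁ (_ : H₁ ∈ Finset.univ) =>
      ObliviousTransfer.le_condEntropy_protocolGiven φ H₀ bob H₁
    rw [Finset.sum_sub_distrib, Finset.sum_const, Finset.card_univ, nsmul_eq_mul] at h1
    nlinarith [mul_le_mul_of_nonneg_left hle' hN.le]
  · refine (ObliviousTransfer.uniform_measure_le
      (fun H₁ => ObliviousTransfer.loss_nonneg φ H₀ H₁) hf0 hloss fun H₁ hH₁ => ?_).trans ?_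
    · have h1 := ObliviousTransfer.le_condEntropy_protocolGiven φ H₀ bob H₁
      change (_ : ℝ) < _ at hH₁
      linarith
    · rw [div_le_iff₀ hf0]
      exact hle
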